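/- Let $X$ be a real Banach space with dual $X^*$, let $c(X)$ be the family of all nonempty closed convex subsets of $X$ and $cb(X)$ the family of all bounded members of $c(X)$. For $C\in c(X)$ and $x^*\in X^*$ put $s(x^*,C)=\sup_{x\in C}\langle x^*,x\rangle\in(-\infty,+\infty]$. Let $\lambda$ be Lebesgue measure on $[0,1]$; an integrable function is allowed to be infinite on a $\lambda$-null set. Definitions. Let $\Gamma:[0,1]\to c(X)$. (a) $\Gamma$ is *scalarly integrable* if $s(x^*,\Gamma(\cdot))$ is Lebesgue integrable for every $x^*\in X^*$. It is *Pettis integrable in $cb(X)$* if it is scalarly integrable and for every Lebesgue measurable $A\subseteq[0,1]$ there is $M(A)\in cb(X)$ with $s(x^*,M(A))=\int_A s(x^*,\Gamma)\,d\lambda$ for all $x^*\in X^*$. (b) A function $g$ on $[a,b]$ is *Denjoy integrable* (in the wide sense, i.e. Denjoy–Khintchine) with integral $F(b)-F(a)$ if $F:[a,b]\to\mathbb R$ is an ACG function (continuous, with $[a,b]$ a countable union of sets on each of which $F$ is AC) whose approximate derivative equals $g$ almost everywhere. $\Gamma$ is *DP-integrable* (Denjoy–Pettis integrable) in $cb(X)$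 if $s(x^*,\Gamma(\cdot))$ is Denjoy integrable on $[0,1]$ for every $x^*\in X^*$ and for every closed interval $I\subseteq[0,1]$ there is $N(I)\in cb(X)$ with $s(x^*,N(I))=(D)\int_I s(x^*,\Gamma)$ for all $x^*\in X^*$. *HKP-integrability* (Henstock–Kurzweil–Pettis) in $cb(X)$ is defined in the same way with the Henstock–Kurzweil integral in place of the Denjoy integral. $\Gamma$ is *weakly McShane (wMS-) integrable* in $cb(X)$ if it is HKP-integrable in $cb(X)$ and scalarly integrable. (c) A function $f:[0,1]\to X$ is *DP-integrable* if $x^*f$ is Denjoy integrable on $[0,1]$ for every $x^*\in X^*$ and for every closed interval $I\subseteq[0,1]$ there is $w_I\in X$ with $\langle x^*,w_I\rangle=(D)\int_I x^*f$ for all $x^*\in X^*$; HKP-integrability of $f$ is defined in the same way with the Henstock–Kurzweil integral, and $f$ is wMS-integrable if it is HKP-integrable and all $x^*f$ are Lebesgue integrable. $\mathcal S_{DP}(\Gamma)$ (resp. $\mathcal S_{HKP}(\Gamma)$, $\mathcal S_{wMS}(\Gamma)$) is the set of all selections $f$ of $\Gamma$ ($f(t)\in\Gamma(t)$ for every $t\in[0,1]$)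 that are scalarly measurable ($x^*f$ is Lebesgue measurable for every $x^*\in X^*$) and DP-integrable (resp. HKP-integrable, wMS-integrable). For such $f$, $\Gamma-f$ is the multifunction $t\mapsto\{x-f(t):x\in\Gamma(t)\}$. Theorem. For every multifunction $\Gamma:[0,1]\to c(X)$ the following conditions are equivalent: (i) $\Gamma$ is DP-integrable in $cb(X)$ and $\mathcal S_{DP}(\Gamma)\neq\emptyset$; (ii) $\mathcal S_{DP}(\Gamma)\neq\emptyset$, and for all $f\in\mathcal S_{DP}(\Gamma)$ the multifunction $\Gamma-f$ is Pettis integrable in $cb(X)$; (iii) there exists $f\in\mathcal S_{DP}(\Gamma)$ such that the multifunction $\Gamma-f$ is Pettis integrable in $cb(X)$. The same equivalence holds with HKP-integrability and $\mathcal S_{HKP}(\Gamma)$, and also with wMS-integrability and $\mathcal S_{wMS}(\Gamma)$, in place of DP-integrability and $\mathcal S_{DP}(\Gamma)$. -/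

import Mathlib

open Set Filter Topology MeasureTheory

noncomputable section

namespace Multifun

/-! ### Real-valued integrals on a compact interval -/

/-- `F` is AC on the set `E`: for every `ε > 0` there is `δ > 0` such that `∑ |F (d i) - F (c i)| < ε`
for every finite family of nonoverlapping intervals `[c i, d i]` with endpoints in `E` and total
length less than `δ`. -/
def ACOn (F : ℝ → ℝ) (E : Set ℝ) : Prop :=
  ∀ ε : ℝ, 0 < ε → ∃ δ : ℝ, 0 < δ ∧ ∀ (n : ℕ) (c d : Fin n → ℝ),
    (∀ i, c i ∈ E ∧ d i ∈ E ∧ c i ≤ d i) →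
    (Pairwise fun i j => Disjoint (Ioo (c i) (d i)) (Ioo (c j) (d j))) →
    ∑ i, (d i - c i) < δ → ∑ i, |F (d i) - F (c i)| < ε

/-- `F` is ACG on `[a, b]`: it is continuous on `[a, b]`, and `[a, b]` is a countable union of sets on
each of which `F` is AC. -/
def ACG (F : ℝ → ℝ) (a b : ℝ) : Prop :=
  ContinuousOn F (Icc a b) ∧
    ∃ E : ℕ → Set ℝ, (⋃ n, E n) = Icc a b ∧ ∀ n, ACOn F (E n)

/-- `x` is a point of (Lebesgue) density of the set `E`. -/
def IsDensityPoint (E : Set ℝ) (x : ℝ) : Prop :=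
  Tendsto (fun h : ℝ => (volume (E ∩ Ioo (x - h) (x + h))).toReal / (2 * h)) (𝓝[>] 0) (𝓝 1)

/-- `F` has approximate derivative `v` at `x`: there is a Lebesgue measurable set `E` having `x` as a
point of density along which `F` has derivative `v` at `x`. -/
def HasApproxDerivAt (F : ℝ → ℝ) (v x : ℝ) : Prop :=
  ∃ E : Set ℝ, NullMeasurableSet E volume ∧ IsDensityPoint E x ∧ HasDerivWithinAt F v E x

/-- `v` is the integral over `[a, b]` of `g` in the sense of Denjoy in the wide sense
(Denjoy-Khintchine): there is an ACG function `F` on `[a, b]` whose approximate derivative is `g`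
almost everywhere, and `v = F b - F a`. -/
def HasDenjoyIntegral (g : ℝ → ℝ) (a b v : ℝ) : Prop :=
  ∃ F : ℝ → ℝ, ACG F a b ∧ (∀ᵐ x ∂volume.restrict (Icc a b), HasApproxDerivAt F (g x) x) ∧
    F b - F a = v

/-- `v` is the Henstock-Kurzweil integral of `g` over `[a, b]`, `a < b`: the one-dimensional case of
Mathlib's Henstock box integral (limit of the Riemann sums over Perron partitions that are subordinate
to a gauge). -/
def HasHKIntegral (g : ℝ → ℝ) (a b v : ℝ) : Prop :=
  ∃ hab : a < b,
    BoxIntegral.HasIntegral (⟨fun _ => a, fun _ => b, fun _ => hab⟩ : BoxIntegral.Box (Fin 1))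
      BoxIntegral.IntegrationParams.Henstock (fun x : Fin 1 → ℝ => g (x 0))
      ((volume : Measure (Fin 1 → ℝ)).toBoxAdditive.toSMul) v

/-! ### Hyperspaces and support functions -/

variable {X : Type*} [NormedAddCommGroup X] [NormedSpace ℝ X]

variable (X) in
/-- `c(X)`: the nonempty closed convex subsets of `X`. -/
def closedConvex : Set (Set X) := {C | C.Nonempty ∧ IsClosed C ∧ Convex ℝ C}

variable (X) in
/-- `cb(X)`: the bounded members of `c(X)`. -/
def closedConvexBounded : Set (Set X) := {C | C ∈ closedConvex X ∧ Bornology.IsBounded C}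

/-- The support function `s(φ, C) = sup {φ x : x ∈ C}`, with values in `[-∞, ∞]`. -/
def supp (φ : StrongDual ℝ X) (C : Set X) : EReal := ⨆ x ∈ C, ((φ x : ℝ) : EReal)

/-- `s(φ, Γ(·))` is finite almost everywhere on `[0, 1]`. -/
def SuppFinite (Γ : ℝ → Set X) (φ : StrongDual ℝ X) : Prop :=
  ∀ᵐ t ∂volume.restrict (Icc (0 : ℝ) 1), supp φ (Γ t) ≠ ⊤ ∧ supp φ (Γ t) ≠ ⊥

/-- The function `s(φ, Γ(·))` as a real function (used together with `SuppFinite Γ φ`; its values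
where `s(φ, Γ(·))` is infinite are then immaterial). -/
def suppFun (Γ : ℝ → Set X) (φ : StrongDual ℝ X) (t : ℝ) : ℝ := (supp φ (Γ t)).toReal

/-! ### Scalarly defined integrals

Multifunctions and functions are defined on `ℝ`; only their values on `[0, 1]` play a role. -/

/-- `Γ` is scalarly (Lebesgue) integrable on `[0, 1]`. -/
def ScalarlyIntegrable (Γ : ℝ → Set X) : Prop :=
  ∀ φ : StrongDual ℝ X, SuppFinite Γ φ ∧ IntegrableOn (suppFun Γ φ) (Icc 0 1) volume

/-- `Γ` is Pettis integrable in the family `𝒞`: it is scalarly integrable, and for each Lebesgue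
measurable `A ⊆ [0, 1]` there is `M ∈ 𝒞` with `s(φ, M) = ∫_A s(φ, Γ)` for all `φ`. -/
def PettisIntegrableIn (𝒞 : Set (Set X)) (Γ : ℝ → Set X) : Prop :=
  ScalarlyIntegrable Γ ∧
    ∀ A : Set ℝ, A ⊆ Icc 0 1 → NullMeasurableSet A volume →
      ∃ M ∈ 𝒞, ∀ φ : StrongDual ℝ X,
        supp φ M = ((∫ t in A, suppFun Γ φ t ∂volume : ℝ) : EReal)

/-- Given a real integral `J` (where `J g a b v` reads "`g` is `J`-integrable on `[a, b]` with integral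
`v`"): `Γ` is scalarly `J`-integrable on `[0, 1]`, and for each interval `[a, b] ⊆ [0, 1]` there is
`N ∈ 𝒞` with `s(φ, N) = (J)∫_a^b s(φ, Γ)` for all `φ`. (For one-point intervals the integral is `0`.) -/
def IntervalIntegrableIn (J : (ℝ → ℝ) → ℝ → ℝ → ℝ → Prop) (𝒞 : Set (Set X))
    (Γ : ℝ → Set X) : Prop :=
  (∀ φ : StrongDual ℝ X, SuppFinite Γ φ ∧ ∃ v : ℝ, J (suppFun Γ φ) 0 1 v) ∧
    ∀ a b : ℝ, 0 ≤ a → a < b → b ≤ 1 →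
      ∃ N ∈ 𝒞, ∀ φ : StrongDual ℝ X, ∃ v : ℝ, J (suppFun Γ φ) a b v ∧ supp φ N = (v : EReal)

/-- Denjoy-Pettis integrability in `𝒞`. -/
def DPIntegrableIn (𝒞 : Set (Set X)) (Γ : ℝ → Set X) : Prop :=
  IntervalIntegrableIn HasDenjoyIntegral 𝒞 Γ

/-- Henstock-Kurzweil-Pettis integrability in `𝒞`. -/
def HKPIntegrableIn (𝒞 : Set (Set X)) (Γ : ℝ → Set X) : Prop :=
  IntervalIntegrableIn HasHKIntegral 𝒞 Γ

/-- Weak McShane integrability in `𝒞`. -/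
def WMSIntegrableIn (𝒞 : Set (Set X)) (Γ : ℝ → Set X) : Prop :=
  HKPIntegrableIn 𝒞 Γ ∧ ScalarlyIntegrable Γ

/-- The single-valued version of `IntervalIntegrableIn`: the integrals over intervals are elements
of `X`. -/
def IntervalIntegrableFun (J : (ℝ → ℝ) → ℝ → ℝ → ℝ → Prop) (f : ℝ → X) : Prop :=
  (∀ φ : StrongDual ℝ X, ∃ v : ℝ, J (fun t => φ (f t)) 0 1 v) ∧
    ∀ a b : ℝ, 0 ≤ a → a < b → b ≤ 1 →
      ∃ w : X, ∀ φ : StrongDual ℝ X, J (fun t => φ (f t)) a b (φ w)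

/-- Denjoy-Pettis integrable functions. -/
def DPIntegrableFun (f : ℝ → X) : Prop := IntervalIntegrableFun HasDenjoyIntegral f

/-- Henstock-Kurzweil-Pettis integrable functions. -/
def HKPIntegrableFun (f : ℝ → X) : Prop := IntervalIntegrableFun HasHKIntegral f

/-- Weakly McShane integrable functions. -/
def WMSIntegrableFun (f : ℝ → X) : Prop :=
  HKPIntegrableFun f ∧
    ∀ φ : StrongDual ℝ X, IntegrableOn (fun t => φ (f t)) (Icc 0 1) volume

/-! ### Selections -/

/-- `f` is a scalarly measurable selection of `Γ` on `[0, 1]`. -/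
def IsScalarlyMeasurableSelection (Γ : ℝ → Set X) (f : ℝ → X) : Prop :=
  (∀ t ∈ Icc (0 : ℝ) 1, f t ∈ Γ t) ∧
    ∀ φ : StrongDual ℝ X, AEMeasurable (fun t => φ (f t)) (volume.restrict (Icc (0 : ℝ) 1))

/-- The scalarly measurable selections of `Γ` that are DP-integrable. -/
def selDP (Γ : ℝ → Set X) : Set (ℝ → X) :=
  {f | IsScalarlyMeasurableSelection Γ f ∧ DPIntegrableFun f}

/-- The scalarly measurable selections of `Γ` that are HKP-integrable. -/
def selHKP (Γ : ℝ → Set X) : Set (ℝ → X) :=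
  {f | IsScalarlyMeasurableSelection Γ f ∧ HKPIntegrableFun f}

/-- The scalarly measurable selections of `Γ` that are weakly McShane integrable. -/
def selWMS (Γ : ℝ → Set X) : Set (ℝ → X) :=
  {f | IsScalarlyMeasurableSelection Γ f ∧ WMSIntegrableFun f}

/-- The multifunction `Γ - f`, i.e. `t ↦ {x - f t : x ∈ Γ t}`. -/
def subFun (Γ : ℝ → Set X) (f : ℝ → X) (t : ℝ) : Set X := (fun x => x - f t) '' Γ t

end Multifun

end

noncomputable section

namespace Multifun

/-! ### Weak* lower semicontinuous sublinear functionals on the dual of a Banach space -/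

section KreinSmulian

variable {X : Type*} [NormedAddCommGroup X] [NormedSpace ℝ X]

/-! Fix a selection `f`. The theorem reduces to one claim: `Γ` is `J`-integrable in `cb(X)` if and
only if `Γ - f` is Pettis integrable, where `J` is the Denjoy or the Henstock-Kurzweil integral.
Since `0 ∈ Γ t - f t`, the function `s(φ, Γ - f) = s(φ, Γ) - φ f` is nonnegative. A nonnegative
`J`-integrable function is Lebesgue integrable with the same integral, so scalar integrability of `Γ
- f` is immediate, and its integrals over intervals are support functions of translates of bounded
convex sets. Conversely the Lebesgue integral is a special case of `J`, and adding back `f`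
translates the sets. `IsLebesgueExtension` isolates what is used about `J`; weak McShane
integrability adds only scalar integrability to the Henstock-Kurzweil case.

The hard point is to pass from intervals to measurable sets `A` (`pettisIntegrableIn_of_intervals`).
The functional `p φ = ∫_A s(φ, G)` is sublinear and bounded by a multiple of `‖φ‖`. By a
Krein-Smulian type argument (`IsBallLscSublinear.exists_eval_gt`), completeness of `X` makes it a
support function as soon as its sublevel sets in the unit ball are weak* closed. Closedness is
`suppIntegral_le_of_mem_closure`. As the weak* topology need not be metrizable, Fatou's lemma cannot
be applied along a net; instead countably many points of `X`, furnished by the integrals over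
rational intervals, control `s(φ₀, G)` almost everywhere, and a convexity argument extracts a
sequence to which Fatou applies.

For the Denjoy integral, nonnegativity is handled by Lusin's condition (N) and monotonicity of ACG
functions with nonnegative approximate derivative; for the Henstock-Kurzweil integral, by the
Saks-Henstock lemma. -/

theorem exists_forall_eval_le_of_isCompact {C : Set (WeakDual ℝ X × ℝ)} (hC : IsCompact C)
    (hconv : Convex ℝ C) {δ s : ℝ} (hδ : (0, -δ) ∉ C) (hs : (0, s) ∈ C) (hsδ : -δ < s) :
    ∃ y : X, ∀ z ∈ C, z.1 y ≤ z.2 + δ := by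
  have : LocallyConvexSpace ℝ (WeakDual ℝ X) :=
    inferInstanceAs (LocallyConvexSpace ℝ (WeakBilin (topDualPairing ℝ X)))
  have : LocallyConvexSpace ℝ (WeakDual ℝ X × ℝ) := inferInstance
  obtain ⟨f, u, hu, hf⟩ := geometric_hahn_banach_point_closed hconv hC.isClosed hδ
  -- Weak* continuous functionals on the dual are evaluations at points of `X`; this is what yields
  -- a point of `X` and not of the bidual.
  obtain ⟨x, hx⟩ := LinearMap.dualEmbedding_surjective (topDualPairing ℝ X)
    (f.comp (ContinuousLinearMap.inl ℝ (WeakDual ℝ X) ℝ))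
  have hx' : ∀ φ : WeakDual ℝ X, φ x = f (φ, 0) := fun φ => by
    have := congrArg (fun g => g φ) hx
    exact this
  set τ : ℝ := f (0, 1)
  have hfd : ∀ (φ : WeakDual ℝ X) (r : ℝ), f (φ, r) = φ x + r * τ := fun φ r => by
    have : ((φ, r) : WeakDual ℝ X × ℝ) = (φ, 0) + r • (0, 1) := by simp
    rw [this, map_add, map_smul, hx' φ, smul_eq_mul]
  have h0 : ∀ x : X, (0 : WeakDual ℝ X) x = 0 := fun _ => rfl
  -- The point `(0, s)` lies vertically above `(0, -δ)`, so the separating hyperplane is not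
  -- vertical and can be normalized to a graph.
  have hτ : 0 < τ := by
    have h1 := hu.trans (hf _ hs)
    rw [hfd, hfd, h0] at h1
    nlinarith
  refine ⟨-(τ⁻¹ • x), fun z hz => ?_⟩
  have h1 := hu.trans (hf z hz)
  rw [hfd, show z = (z.1, z.2) from rfl, hfd, h0] at h1
  rw [map_neg, map_smul, smul_eq_mul]
  have h2 : -(z.2 + δ) * τ < z.1 x := by linarith
  have h3 : -(z.2 + δ) < τ⁻¹ * z.1 x := by
    rw [← div_eq_inv_mul, lt_div_iff₀ hτ]; exact h2
  linarith

/-- The hypothesis `h` says that `C + D` does not go below height `0` over the origin, so `(0, -δ)`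
can be separated from `C + D`. As both sets contain `0`, domination on the sum gives domination on
each. With epigraphs for `C` and `D` this is an approximate sandwich theorem with an evaluation in
the middle. -/
theorem exists_forall_eval_le_of_isCompact_pair {C D : Set (WeakDual ℝ X × ℝ)} (hC : IsCompact C)
    (hD : IsCompact D) (hCc : Convex ℝ C) (hDc : Convex ℝ D) (hC0 : 0 ∈ C) (hD0 : 0 ∈ D)
    (h : ∀ φ s t, (φ, s) ∈ C → (-φ, t) ∈ D → 0 ≤ s + t) {δ : ℝ} (hδ : 0 < δ) :
    ∃ y : X, (∀ z ∈ C, z.1 y ≤ z.2 + δ) ∧ ∀ z ∈ D, z.1 y ≤ z.2 + δ := by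
  obtain ⟨y, hy⟩ := exists_forall_eval_le_of_isCompact (δ := δ) (s := 0) (hC.add hD) (hCc.add hDc)
    (by
      rintro ⟨⟨φ, s⟩, hs, ⟨ψ, t⟩, ht, hst⟩
      simp only [Prod.mk_add_mk, Prod.mk.injEq] at hst
      obtain rfl : ψ = -φ := (neg_eq_of_add_eq_zero_right hst.1).symm
      have := h φ s t hs ht
      linarith [hst.2])
    ⟨0, hC0, 0, hD0, add_zero 0⟩ (by linarith)
  exact ⟨y, fun z hz => hy z ⟨z, hz, 0, hD0, by simp⟩, fun z hz => hy z ⟨0, hC0, z, hz, by simp⟩⟩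

theorem norm_sub_le_of_forall {x y : X} {c : ℝ}
    (h : ∀ φ : StrongDual ℝ X, ‖φ‖ ≤ 1 → φ y ≤ φ x + c) : ‖y - x‖ ≤ c := by
  obtain ⟨φ, hφ, h1⟩ := exists_dual_vector'' ℝ (y - x)
  have h2 := h φ hφ
  rw [map_sub] at h1
  simp only [RCLike.ofReal_real_eq_id, id] at h1
  linarith

/-- A bounded sublinear functional on the dual which is weak* lower semicontinuous on the unit
ball. -/
structure IsBallLscSublinear (p : StrongDual ℝ X → ℝ) (K : ℝ) : Prop where
  add_le : ∀ φ ψ, p (φ + ψ) ≤ p φ + p ψ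
  smul : ∀ (c : ℝ) φ, 0 ≤ c → p (c • φ) = c * p φ
  le_norm : ∀ φ, p φ ≤ K * ‖φ‖
  isClosed : ∀ c : ℝ, IsClosed {φ : WeakDual ℝ X |
    ‖WeakDual.toStrongDual φ‖ ≤ 1 ∧ p (WeakDual.toStrongDual φ) ≤ c}

variable {p : StrongDual ℝ X → ℝ} {K : ℝ}

/-- The part of the epigraph of `p` over the unit ball that lies below the level `K`. -/
def ballEpigraph (p : StrongDual ℝ X → ℝ) (K : ℝ) : Set (WeakDual ℝ X × ℝ) :=
  {z | ‖WeakDual.toStrongDual z.1‖ ≤ 1 ∧ p (WeakDual.toStrongDual z.1) ≤ z.2 ∧ z.2 ≤ K}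

namespace IsBallLscSublinear

theorem map_zero (hp : IsBallLscSublinear p K) : p 0 = 0 := by
  simpa using hp.smul 0 0 le_rfl

theorem neg_le (hp : IsBallLscSublinear p K) (φ : StrongDual ℝ X) : -(K * ‖φ‖) ≤ p φ := by
  have h1 := hp.add_le φ (-φ)
  rw [add_neg_cancel, hp.map_zero] at h1
  have h3 := hp.le_norm (-φ)
  rw [norm_neg] at h3
  linarith

theorem isCompact_ballEpigraph (hp : IsBallLscSublinear p K) (hK : 0 ≤ K) :
    IsCompact (ballEpigraph p K) := by
  have hcl : IsClosed (ballEpigraph p K) := by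
    -- `p φ ≤ s` holds exactly when `p φ ≤ c` for all `c > s`, which writes the epigraph in terms of
    -- the closed sublevel sets.
    have : ballEpigraph p K = {z | z.2 ≤ K} ∩ ⋂ c : ℝ, ({z | c ≤ z.2} ∪
        Prod.fst ⁻¹' {φ : WeakDual ℝ X | ‖WeakDual.toStrongDual φ‖ ≤ 1 ∧
          p (WeakDual.toStrongDual φ) ≤ c}) := by
      ext z
      simp only [ballEpigraph, mem_ofPred_eq, mem_inter_iff, mem_iInter, mem_union, mem_preimage]
      constructor
      · rintro ⟨h1, h2, h3⟩
        refine ⟨h3, fun c => ?_⟩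
        rcases le_or_gt c z.2 with h | h
        · exact Or.inl h
        · exact Or.inr ⟨h1, h2.trans h.le⟩
      · rintro ⟨h3, h⟩
        refine ⟨?_, ?_, h3⟩
        · rcases h (z.2 + 1) with h | h
          · linarith
          · exact h.1
        · refine le_of_forall_gt_imp_ge_of_dense fun c hc => ?_
          rcases h c with h | h
          · exact absurd hc h.not_gt
          · exact h.2
    rw [this]
    refine (isClosed_le continuous_snd continuous_const).inter (isClosed_iInter fun c => ?_)
    exact (isClosed_le continuous_const continuous_snd).union ((hp.isClosed c).preimage continuous_fst)
  refine ((WeakDual.isCompact_closedBall (0 : StrongDual ℝ X) 1).prod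
    (isCompact_Icc (a := -K) (b := K))).of_isClosed_subset hcl ?_
  rintro ⟨φ, s⟩ ⟨h1, h2, h3⟩
  refine ⟨by simpa using h1, ?_, h3⟩
  have := hp.neg_le (WeakDual.toStrongDual φ)
  simp only at h1 h2 ⊢
  nlinarith

theorem convex_ballEpigraph (hp : IsBallLscSublinear p K) : Convex ℝ (ballEpigraph p K) := by
  rintro ⟨φ, s⟩ ⟨h1, h2, h3⟩ ⟨ψ, t⟩ ⟨h4, h5, h6⟩ a b ha hb hab
  simp only at h1 h2 h3 h4 h5 h6
  refine ⟨?_, ?_, ?_⟩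
  · simp only [Prod.smul_mk, Prod.mk_add_mk, map_add, map_smul]
    refine (norm_add_le _ _).trans ?_
    rw [norm_smul, norm_smul, Real.norm_of_nonneg ha, Real.norm_of_nonneg hb]
    nlinarith
  · simp only [Prod.smul_mk, Prod.mk_add_mk, map_add, map_smul, smul_eq_mul]
    refine (hp.add_le _ _).trans ?_
    rw [hp.smul _ _ ha, hp.smul _ _ hb]
    nlinarith
  · simp only [Prod.smul_mk, Prod.mk_add_mk, smul_eq_mul]
    calc a * s + b * t ≤ a * K + b * K := by gcongr
      _ = K := by rw [← add_mul, hab, one_mul]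

theorem zero_mem_ballEpigraph (hp : IsBallLscSublinear p K) (hK : 0 ≤ K) :
    (0 : WeakDual ℝ X × ℝ) ∈ ballEpigraph p K := by
  refine ⟨?_, ?_, hK⟩
  · simp
  · simp [hp.map_zero]

theorem le_add_norm_of_ball (hp : IsBallLscSublinear p K) {δ : ℝ} {y : X}
    (h : ∀ φ : StrongDual ℝ X, ‖φ‖ ≤ 1 → φ y ≤ p φ + δ) (φ : StrongDual ℝ X) :
    φ y ≤ p φ + δ * ‖φ‖ := by
  rcases eq_or_ne φ 0 with rfl | hφ
  · simp [hp.map_zero]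
  have hn : 0 < ‖φ‖ := norm_pos_iff.2 hφ
  have h1 := h (‖φ‖⁻¹ • φ) (by rw [norm_smul, norm_inv, norm_norm, inv_mul_cancel₀ hn.ne'])
  rw [hp.smul _ _ (by positivity), smul_apply, smul_eq_mul] at h1
  have h2 := mul_le_mul_of_nonneg_left h1 hn.le
  rw [← mul_assoc, mul_inv_cancel₀ hn.ne', one_mul, mul_add, ← mul_assoc,
    mul_inv_cancel₀ hn.ne', one_mul] at h2
  linarith

/-- Approximate representation of `p` near a point `φ₀`. -/
theorem exists_approx (hp : IsBallLscSublinear p K) (hK : 0 ≤ K) {φ₀ : StrongDual ℝ X} {r : ℝ}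
    (hr : r ≤ p φ₀) {δ : ℝ} (hδ : 0 < δ) :
    ∃ y : X, (∀ φ : StrongDual ℝ X, φ y ≤ p φ + δ * ‖φ‖) ∧ r - δ ≤ φ₀ y := by
  -- Domination at `w` reads `-φ₀ y ≤ -r + δ`, the wanted lower bound. The second set is the segment
  -- from `0` to `w`, convex and containing `0`; compatibility with the epigraph is `l * r ≤ p (l •
  -- φ₀)`.
  set w : WeakDual ℝ X × ℝ := (-StrongDual.toWeakDual φ₀, -r) with hw
  obtain ⟨y, hy, hy'⟩ := exists_forall_eval_le_of_isCompact_pair (C := ballEpigraph p K)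
    (D := (fun l : ℝ => l • w) '' Icc 0 1) (hp.isCompact_ballEpigraph hK)
    (isCompact_Icc.image (by fun_prop)) hp.convex_ballEpigraph
    ((convex_Icc (0 : ℝ) 1).is_linear_image ⟨fun a b => add_smul a b w, fun c a => by
      rw [smul_eq_mul, mul_smul]⟩)
    (hp.zero_mem_ballEpigraph hK) ⟨0, by simp, by simp⟩ (by
      rintro φ s t ⟨-, h2, -⟩ ⟨l, hl, h⟩
      simp only [hw, Prod.smul_mk, Prod.mk.injEq, smul_neg, neg_inj, smul_eq_mul] at h
      obtain ⟨rfl, rfl⟩ := h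
      simp only [map_smul] at h2
      have h3 : p (l • φ₀) ≤ s := h2
      rw [hp.smul _ _ hl.1] at h3
      have := mul_le_mul_of_nonneg_left hr hl.1
      linarith) hδ
  refine ⟨y, hp.le_add_norm_of_ball fun φ hφ => ?_, ?_⟩
  · refine hy (StrongDual.toWeakDual φ, p φ) ⟨hφ, le_rfl, ?_⟩
    have := hp.le_norm φ
    simp only
    nlinarith
  · have h1 := hy' w ⟨1, by simp, by simp⟩
    have h2 : w.1 y = - φ₀ y := rfl
    rw [h2] at h1
    simp only [hw] at h1
    linarith

/-- An approximately `p`-dominated point can be moved slightly to improve the approximation. -/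
theorem exists_improve (hp : IsBallLscSublinear p K) (hK : 0 ≤ K) {x : X} {ε δ : ℝ} (hε : 0 < ε)
    (hx : ∀ φ : StrongDual ℝ X, φ x ≤ p φ + ε * ‖φ‖) (hδ : 0 < δ) :
    ∃ y : X, (∀ φ : StrongDual ℝ X, φ y ≤ p φ + δ * ‖φ‖) ∧ ‖y - x‖ ≤ ε + δ := by
  have hnorm : ∀ (φ : WeakDual ℝ X) (z : X),
      |φ z| ≤ ‖WeakDual.toStrongDual φ‖ * ‖z‖ := fun φ z => (WeakDual.toStrongDual φ).le_opNorm z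
  set L := ‖x‖ + ε with hL
  have hL0 : 0 ≤ L := by positivity
  -- The epigraph, over the unit ball and below level `L`, of `φ ↦ φ x + ε * ‖φ‖`, the support
  -- function of the ball of radius `ε` about `x`. The norm is expressed through vectors `u` so that
  -- weak* closedness is visible. `L` bounds this function on the unit ball, so the truncation loses
  -- nothing.
  set D : Set (WeakDual ℝ X × ℝ) := {z | ‖WeakDual.toStrongDual z.1‖ ≤ 1 ∧ z.2 ≤ L ∧
    ∀ u : X, ‖u‖ ≤ 1 → z.1 x + ε * z.1 u ≤ z.2} with hD
  have hev : ∀ u : X, Continuous fun z : WeakDual ℝ X × ℝ => z.1 u := fun u =>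
    (WeakDual.eval_continuous u).comp continuous_fst
  have hDeq : D = ((WeakDual.toStrongDual ⁻¹' Metric.closedBall (0 : StrongDual ℝ X) 1) ×ˢ
      Icc (-L) L) ∩ ⋂ u : X, ⋂ _ : ‖u‖ ≤ 1, {z | z.1 x + ε * z.1 u ≤ z.2} := by
    ext z
    simp only [hD, mem_ofPred_eq, mem_inter_iff, mem_prod, mem_preimage, Metric.mem_closedBall,
      dist_zero_right, mem_iInter, mem_Icc]
    constructor
    · rintro ⟨h1, h2, h3⟩
      refine ⟨⟨h1, ?_, h2⟩, h3⟩
      have h4 := h3 0 (by simp)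
      rw [_root_.map_zero, mul_zero, add_zero] at h4
      have h5 := neg_abs_le (z.1 x)
      have h6 := hnorm z.1 x
      nlinarith [norm_nonneg x]
    · rintro ⟨⟨h1, -, h2⟩, h3⟩
      exact ⟨h1, h2, h3⟩
  have hDcomp : IsCompact D := by
    rw [hDeq]
    refine ((WeakDual.isCompact_closedBall (0 : StrongDual ℝ X) 1).prod isCompact_Icc).inter_right
      (isClosed_iInter fun u => isClosed_iInter fun _ => ?_)
    exact isClosed_le ((hev x).add (continuous_const.mul (hev u))) continuous_snd
  have hDconv : Convex ℝ D := by
    rintro ⟨φ, s⟩ ⟨h1, h2, h3⟩ ⟨ψ, t⟩ ⟨h4, h5, h6⟩ a b ha hb hab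
    simp only at h1 h2 h3 h4 h5 h6
    refine ⟨?_, ?_, fun u hu => ?_⟩
    · simp only [Prod.smul_mk, Prod.mk_add_mk, map_add, map_smul]
      refine (norm_add_le _ _).trans ?_
      rw [norm_smul, norm_smul, Real.norm_of_nonneg ha, Real.norm_of_nonneg hb]
      nlinarith
    · simp only [Prod.smul_mk, Prod.mk_add_mk, smul_eq_mul]
      calc a * s + b * t ≤ a * L + b * L := by gcongr
        _ = L := by rw [← add_mul, hab, one_mul]
    · have h7 := h3 u hu
      have h8 := h6 u hu
      have e : ∀ v : X, (a • φ + b • ψ) v = a * φ v + b * ψ v := fun v => rfl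
      simp only [Prod.smul_mk, Prod.mk_add_mk, smul_eq_mul, e]
      nlinarith
  obtain ⟨y, hy, hy'⟩ := exists_forall_eval_le_of_isCompact_pair (hp.isCompact_ballEpigraph hK)
    hDcomp hp.convex_ballEpigraph hDconv (hp.zero_mem_ballEpigraph hK)
    (by
      refine ⟨by simp, hL0, fun u _ => ?_⟩
      have h0 : ∀ x : X, (0 : WeakDual ℝ X) x = 0 := fun _ => rfl
      simp [h0]) (by
      rintro φ s t ⟨-, h2, -⟩ ⟨-, -, h3⟩
      simp only at h2 h3
      have e : ∀ v : X, (-φ : WeakDual ℝ X) v = - φ v := fun v => rfl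
      have h4 := hx (WeakDual.toStrongDual φ)
      have e' : WeakDual.toStrongDual φ x = φ x := rfl
      have h0 : 0 ≤ (t + φ x) / ε := by
        have := h3 0 (by simp)
        rw [e, _root_.map_zero, mul_zero, add_zero] at this
        have : 0 ≤ t + φ x := by linarith
        positivity
      have h5 : ‖WeakDual.toStrongDual φ‖ ≤ (t + φ x) / ε := by
        refine ContinuousLinearMap.opNorm_le_of_unit_norm h0 fun u hu => ?_
        have h6 := h3 u hu.le
        have h7 := h3 (-u) (by rw [norm_neg, hu])
        have e1 : WeakDual.toStrongDual φ u = φ u := rfl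
        rw [e1, Real.norm_eq_abs, abs_le, le_div_iff₀ hε]
        rw [e, e] at h6
        rw [e, e, map_neg] at h7
        constructor
        · rw [_root_.neg_le, le_div_iff₀ hε]; linarith
        · linarith
      rw [le_div_iff₀ hε] at h5
      rw [e'] at h4
      linarith) hδ
  refine ⟨y, hp.le_add_norm_of_ball fun φ hφ => ?_, norm_sub_le_of_forall fun φ hφ => ?_⟩
  · refine hy (StrongDual.toWeakDual φ, p φ) ⟨hφ, le_rfl, ?_⟩
    have := hp.le_norm φ
    simp only
    nlinarith
  · have h1 : φ y ≤ φ x + ε + δ := by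
      refine hy' (StrongDual.toWeakDual φ, φ x + ε) ⟨hφ, ?_, fun u hu => ?_⟩
      · have h2 := (le_abs_self (φ x)).trans (φ.le_opNorm x)
        have h3 : ‖φ‖ * ‖x‖ ≤ 1 * ‖x‖ := by gcongr
        simp only [hL]
        linarith
      · have h2 := (le_abs_self (φ u)).trans (φ.le_opNorm u)
        have h3 : ‖φ‖ * ‖u‖ ≤ 1 := by nlinarith [norm_nonneg φ, norm_nonneg u]
        change φ x + ε * φ u ≤ φ x + ε
        nlinarith
    linarith

/-- A sublinear functional on the dual of a Banach space which is bounded and weak* lower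
semicontinuous on the unit ball is the support function of a subset of the space. -/
theorem exists_eval_gt [CompleteSpace X] (hp : IsBallLscSublinear p K) (hK : 0 ≤ K)
    {φ₀ : StrongDual ℝ X} {r : ℝ} (hr : r < p φ₀) :
    ∃ x : X, (∀ φ : StrongDual ℝ X, φ x ≤ p φ) ∧ r < φ₀ x := by
  -- The successive corrections move `x₀` by at most `4 * δ` in total, so `φ₀` at the limit is at
  -- least `p φ₀ - δ - 4 * δ * ‖φ₀‖ = r + δ`.
  set δ : ℝ := (p φ₀ - r) / (2 + 4 * ‖φ₀‖) with hδ
  have hden : 0 < 2 + 4 * ‖φ₀‖ := by positivity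
  have hδ0 : 0 < δ := div_pos (by linarith) hden
  obtain ⟨x₀, hx₀, hx₀r⟩ := hp.exists_approx hK le_rfl hδ0 (φ₀ := φ₀)
  set ε : ℕ → ℝ := fun n => δ * (1 / 2) ^ n with hεdef
  have hε : ∀ n, 0 < ε n := fun n => by positivity
  have hstep : ∀ n, ∀ x : {x : X // ∀ φ : StrongDual ℝ X, φ x ≤ p φ + ε n * ‖φ‖},
      ∃ y : {x : X // ∀ φ : StrongDual ℝ X, φ x ≤ p φ + ε (n + 1) * ‖φ‖},
        ‖(y : X) - x‖ ≤ ε n + ε (n + 1) := fun n x => by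
    obtain ⟨y, hy, hyx⟩ := hp.exists_improve hK (hε n) x.2 (hε (n + 1))
    exact ⟨⟨y, hy⟩, hyx⟩
  choose F hF using hstep
  let u : ∀ n, {x : X // ∀ φ : StrongDual ℝ X, φ x ≤ p φ + ε n * ‖φ‖} := fun n =>
    Nat.rec ⟨x₀, by simpa [hεdef] using hx₀⟩ (fun n x => F n x) n
  have hu : ∀ n, dist (u n).1 (u (n + 1)).1 ≤ 2 * δ * (1 / 2) ^ n := fun n => by
    rw [dist_comm, dist_eq_norm]
    refine (hF n (u n)).trans ?_
    have : (0 : ℝ) < (1 / 2) ^ n := by positivity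
    simp only [hεdef, pow_succ]
    nlinarith
  obtain ⟨x, hx⟩ := cauchySeq_tendsto_of_complete
    (cauchySeq_of_le_geometric (1 / 2) (2 * δ) (by norm_num) hu)
  refine ⟨x, fun φ => ?_, ?_⟩
  · have h1 : Tendsto (fun n => φ (u n).1) atTop (𝓝 (φ x)) := (φ.continuous.tendsto x).comp hx
    have h2 : Tendsto (fun n => p φ + ε n * ‖φ‖) atTop (𝓝 (p φ + δ * 0 * ‖φ‖)) :=
      (((tendsto_pow_atTop_nhds_zero_of_lt_one (by norm_num) (by norm_num)).const_mul δ).mul_const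
        _).const_add _
    have h3 := le_of_tendsto_of_tendsto' h1 h2 fun n => (u n).2 φ
    simpa using h3
  · have h1 := dist_le_of_le_geometric_of_tendsto₀ (1 / 2) (2 * δ) (by norm_num) hu hx
    have h2 : ‖x₀ - x‖ ≤ 4 * δ := by
      rw [← dist_eq_norm]
      refine h1.trans (le_of_eq ?_)
      ring
    have h3 := (le_abs_self _).trans (φ₀.le_opNorm (x₀ - x))
    rw [map_sub] at h3
    have h4 : ‖φ₀‖ * ‖x₀ - x‖ ≤ ‖φ₀‖ * (4 * δ) := by gcongr
    have h5 : δ * (2 + 4 * ‖φ₀‖) = p φ₀ - r := div_mul_cancel₀ _ hden.ne'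
    nlinarith

end IsBallLscSublinear

end KreinSmulian

/-! ### Convergent sequences in midpoint convex families of functions -/

theorem norm_toLp_sq {α : Type*} [MeasurableSpace α] {μ : Measure α} {f : α → ℝ}
    (hf : MemLp f 2 μ) : ‖hf.toLp f‖ ^ 2 = ∫ t, f t ^ 2 ∂μ := by
  rw [← real_inner_self_eq_norm_sq, L2.inner_def]
  refine integral_congr_ae ?_
  filter_upwards [hf.coeFn_toLp] with t ht
  rw [ht, real_inner_self_eq_norm_sq, Real.norm_eq_abs, sq_abs]

/-- Strict convexity of `exp (-·)` replaces compactness. Almost minimizing `∫ exp (-g)` over `C n`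
gives a sequence for which `a n = exp (-g n / 2)` is Cauchy in `L²`, by the identity `(a n - a m)² =
exp (-g n) + exp (-g m) - 2 * exp (-(g n + g m) / 2)`. No integral bound on `g` is needed: where the
limit is `0`, the functions tend to `+∞`. -/
theorem exists_seq_tendsto_exp_neg {α : Type*} [MeasurableSpace α] (μ : Measure α)
    [IsFiniteMeasure μ] (C : ℕ → Set (α → ℝ)) (hanti : Antitone C) (hne : ∀ n, (C n).Nonempty)
    (hmeas : ∀ n, ∀ g ∈ C n, AEMeasurable g μ) (hpos : ∀ n, ∀ g ∈ C n, 0 ≤ᵐ[μ] g)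
    (hmid : ∀ n, ∀ g ∈ C n, ∀ h ∈ C n, (fun t => (g t + h t) / 2) ∈ C n) :
    ∃ (g : ℕ → α → ℝ) (r : α → ℝ), (∀ n, g n ∈ C n) ∧
      ∀ᵐ t ∂μ, Tendsto (fun n => Real.exp (-(g n t / 2))) atTop (𝓝 (r t)) := by
  have hexpm : ∀ n, ∀ g ∈ C n, ∀ c : ℝ, AEStronglyMeasurable (fun t => Real.exp (-(g t / c))) μ :=
    fun n g hg c => (Real.measurable_exp.comp_aemeasurable
      ((hmeas n g hg).div_const c).neg).aestronglyMeasurable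
  have hexpb : ∀ n, ∀ g ∈ C n, ∀ c : ℝ, 0 < c → ∀ᵐ t ∂μ, ‖Real.exp (-(g t / c))‖ ≤ 1 :=
    fun n g hg c hc => by
      filter_upwards [hpos n g hg] with t ht
      rw [Real.norm_of_nonneg (Real.exp_pos _).le, Real.exp_le_one_iff, neg_nonpos]
      exact div_nonneg ht hc.le
  have hint : ∀ n, ∀ g ∈ C n, Integrable (fun t => Real.exp (-(g t))) μ := fun n g hg => by
    have := Integrable.of_bound (hexpm n g hg 1) 1 (hexpb n g hg 1 one_pos)
    simpa using this
  set E : (α → ℝ) → ℝ := fun g => ∫ t, Real.exp (-(g t)) ∂μ with hE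
  set I : ℕ → ℝ := fun n => sInf (E '' C n) with hI
  have hE0 : ∀ g, 0 ≤ E g := fun g => integral_nonneg fun t => (Real.exp_pos _).le
  have hbdd : ∀ n, BddBelow (E '' C n) := fun n => ⟨0, by rintro _ ⟨g, -, rfl⟩; exact hE0 g⟩
  have hIle : ∀ n, ∀ g ∈ C n, I n ≤ E g := fun n g hg => csInf_le (hbdd n) ⟨g, hg, rfl⟩
  have hEle : ∀ n, ∀ g ∈ C n, E g ≤ μ.real univ := fun n g hg => by
    have h1 : E g ≤ ∫ _, (1 : ℝ) ∂μ := by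
      refine integral_mono_ae (hint n g hg) (integrable_const _) ?_
      filter_upwards [hexpb n g hg 1 one_pos] with t ht
      rw [Real.norm_of_nonneg (Real.exp_pos _).le, div_one] at ht
      exact ht
    simpa using h1
  have hImono : Monotone I := fun n m hnm =>
    csInf_le_csInf (hbdd n) ((hne m).image E) (image_mono (hanti hnm))
  have hIbdd : BddAbove (range I) := ⟨μ.real univ, by
    rintro _ ⟨n, rfl⟩
    obtain ⟨g, hg⟩ := hne n
    exact (hIle n g hg).trans (hEle n g hg)⟩
  set L := ⨆ n, I n with hL
  have hIL : Tendsto I atTop (𝓝 L) := tendsto_atTop_ciSup hImono hIbdd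
  have hchoose : ∀ n : ℕ, ∃ g ∈ C n, E g < I n + 1 / ((n : ℝ) + 1) := fun n => by
    obtain ⟨_, ⟨g, hg, rfl⟩, h⟩ := exists_lt_of_csInf_lt ((hne n).image E)
      (show sInf (E '' C n) < I n + 1 / ((n : ℝ) + 1) from lt_add_of_pos_right _ (by positivity))
    exact ⟨g, hg, h⟩
  choose g hg hgI using hchoose
  set a : ℕ → α → ℝ := fun n t => Real.exp (-(g n t / 2)) with ha
  have haL : ∀ n, MemLp (a n) 2 μ := fun n =>
    MemLp.of_bound (hexpm n _ (hg n) 2) 1 (hexpb n _ (hg n) 2 two_pos)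
  -- The midpoint of `g n` and `g m` stays in `C n`, so its integral is at least `I n`, while those
  -- of the two functions are at most `I n + 1 / (n + 1)` and `L + 1 / (n + 1)`.
  have hdist : ∀ n m, n ≤ m → dist ((haL n).toLp (a n)) ((haL m).toLp (a m)) ≤
      Real.sqrt ((L - I n) + 2 / ((n : ℝ) + 1)) := fun n m hnm => by
    have hgm := hanti hnm (hg m)
    have hk := hmid n _ (hg n) _ hgm
    refine Real.le_sqrt_of_sq_le ?_
    rw [dist_eq_norm, ← MemLp.toLp_sub, norm_toLp_sq]
    have h1 : ∫ t, (a n - a m) t ^ 2 ∂μ = E (g n) + E (g m) - 2 * E (fun t => (g n t + g m t) / 2) := by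
      have i1 := hint n _ (hg n)
      have i2 := hint n _ hgm
      have i3 := hint n _ hk
      simp only [hE]
      rw [← integral_add i1 i2, ← integral_const_mul]
      refine Eq.trans ?_ (integral_sub (i1.add i2) (i3.const_mul 2))
      refine integral_congr_ae (Eventually.of_forall fun t => ?_)
      simp only [ha, Pi.sub_apply, sub_sq, ← Real.exp_nat_mul, mul_assoc, ← Real.exp_add]
      have e1 : ((2 : ℕ) : ℝ) * (-(g n t / 2)) = -(g n t) := by push_cast; ring
      have e2 : ((2 : ℕ) : ℝ) * (-(g m t / 2)) = -(g m t) := by push_cast; ring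
      have e3 : -(g n t / 2) + -(g m t / 2) = -((g n t + g m t) / 2) := by ring
      rw [e1, e2, e3]
      ring
    rw [h1]
    have h2 := hIle n _ hk
    have h3 := (hgI n).le
    have h4 := (hgI m).le
    have h5 : I m ≤ L := le_ciSup hIbdd m
    have h6 : 1 / ((m : ℝ) + 1) ≤ 1 / ((n : ℝ) + 1) := by gcongr
    have h7 : 2 / ((n : ℝ) + 1) = 1 / ((n : ℝ) + 1) + 1 / ((n : ℝ) + 1) := by ring
    linarith
  have hlim : Tendsto (fun n : ℕ => Real.sqrt ((L - I n) + 2 / ((n : ℝ) + 1))) atTop (𝓝 0) := by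
    have h1 : Tendsto (fun n : ℕ => (L - I n) + 2 / ((n : ℝ) + 1)) atTop (𝓝 ((L - L) + 2 * 0)) := by
      refine (hIL.const_sub L).add ?_
      simpa only [mul_one_div] using tendsto_one_div_add_atTop_nhds_zero_nat.const_mul (2 : ℝ)
    have h2 := (Real.continuous_sqrt.tendsto _).comp h1
    simpa [Function.comp_def] using h2
  obtain ⟨f, hf⟩ := cauchySeq_tendsto_of_complete (cauchySeq_of_le_tendsto_0' _ hdist hlim)
  obtain ⟨ns, hns, hae⟩ := (tendstoInMeasure_of_tendsto_Lp hf).exists_seq_tendsto_ae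
  refine ⟨fun k => g (ns k), f, fun k => hanti (hns.id_le k) (hg _), ?_⟩
  have hco : ∀ᵐ t ∂μ, ∀ n, (haL n).toLp (a n) t = a n t := ae_all_iff.2 fun n => (haL n).coeFn_toLp
  filter_upwards [hae, hco] with t ht hct
  simpa only [hct] using ht

/-! ### Comparison of integrable functions by means of rational intervals -/

/-- Lebesgue differentiation in its version for balls that contain `x` without being centred there:
rational centres within `1 / (n + 1)` of `x` and radius `1 / (n + 1)` give intervals with rational
endpoints. -/
theorem ae_le_of_forall_rat_setIntegral_le {u v : ℝ → ℝ} (hu : IntegrableOn u (Icc 0 1))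
    (hv : IntegrableOn v (Icc 0 1))
    (h : ∀ a b : ℚ, (0 : ℝ) ≤ a → (a : ℝ) < b → (b : ℝ) ≤ 1 →
      ∫ t in Icc (a : ℝ) b, u t ≤ ∫ t in Icc (a : ℝ) b, v t) :
    ∀ᵐ t ∂volume.restrict (Icc (0 : ℝ) 1), u t ≤ v t := by
  set f : ℝ → ℝ := (Icc (0 : ℝ) 1).indicator (v - u) with hf
  have hfi : Integrable f := (hv.sub hu).integrable_indicator measurableSet_Icc
  rw [← restrict_Ioo_eq_restrict_Icc, ae_restrict_iff' measurableSet_Ioo]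
  filter_upwards [IsUnifLocDoublingMeasure.ae_tendsto_average volume hfi.locallyIntegrable 1]
    with x hx hx01
  have hw : ∀ n : ℕ, ∃ q : ℚ, |x - q| < 1 / ((n : ℝ) + 1) := fun n => by
    obtain ⟨q, hq⟩ := exists_rat_near x (show (0 : ℝ) < 1 / ((n : ℝ) + 1) by positivity)
    exact ⟨q, hq⟩
  choose w hw using hw
  have h0 : Tendsto (fun n : ℕ => 1 / ((n : ℝ) + 1)) atTop (𝓝 0) :=
    tendsto_one_div_add_atTop_nhds_zero_nat
  have hlim := hx (fun n => (w n : ℝ)) (fun n : ℕ => 1 / ((n : ℝ) + 1))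
    (tendsto_nhdsWithin_iff.2 ⟨h0, Eventually.of_forall fun n => by
      simp only [mem_Ioi]; positivity⟩)
    (Eventually.of_forall fun n => by
      rw [Metric.mem_closedBall, Real.dist_eq, one_mul]; exact (hw n).le)
  have hfx : f x = v x - u x := by
    rw [hf, indicator_of_mem (Ioo_subset_Icc_self hx01)]; rfl
  rw [hfx] at hlim
  have hmin : 0 < min x (1 - x) / 2 := by
    have : 0 < min x (1 - x) := lt_min hx01.1 (by linarith [hx01.2])
    positivity
  have hnn : ∀ᶠ n : ℕ in atTop, 0 ≤ ⨍ y in Metric.closedBall (w n : ℝ) (1 / ((n : ℝ) + 1)), f y := by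
    filter_upwards [h0.eventually (gt_mem_nhds hmin)] with n hn
    have hb := abs_lt.1 (hw n)
    have h1 : min x (1 - x) ≤ x := min_le_left _ _
    have h2 : min x (1 - x) ≤ 1 - x := min_le_right _ _
    have hd : (0 : ℝ) < 1 / ((n : ℝ) + 1) := by positivity
    have ha0 : (0 : ℝ) ≤ w n - 1 / ((n : ℝ) + 1) := by linarith
    have hb1 : (w n : ℝ) + 1 / ((n : ℝ) + 1) ≤ 1 := by linarith
    have hsub : Icc ((w n : ℝ) - 1 / ((n : ℝ) + 1)) (w n + 1 / ((n : ℝ) + 1)) ⊆ Icc 0 1 :=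
      Icc_subset_Icc ha0 hb1
    rw [setAverage_eq, smul_eq_mul, Real.closedBall_eq_Icc]
    refine mul_nonneg (by positivity) ?_
    have h3 : ∫ y in Icc ((w n : ℝ) - 1 / ((n : ℝ) + 1)) (w n + 1 / ((n : ℝ) + 1)), f y =
        ∫ y in Icc ((w n : ℝ) - 1 / ((n : ℝ) + 1)) (w n + 1 / ((n : ℝ) + 1)), (v y - u y) :=
      setIntegral_congr_fun measurableSet_Icc fun y hy => by
        simp only [hf]
        rw [indicator_of_mem (hsub hy)]; rfl
    rw [h3, integral_sub (hv.mono_set hsub) (hu.mono_set hsub), sub_nonneg]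
    have h4 := h (w n - 1 / ((n : ℚ) + 1)) (w n + 1 / ((n : ℚ) + 1)) (by push_cast; exact ha0)
      (by push_cast; linarith) (by push_cast; exact hb1)
    push_cast at h4
    exact h4
  linarith [ge_of_tendsto hlim hnn]

section Extension

variable {X : Type*} [NormedAddCommGroup X] [NormedSpace ℝ X]

/-! ### Support functions of sets containing the origin -/

theorem supp_nonneg {C : Set X} (h0 : 0 ∈ C) (φ : StrongDual ℝ X) : 0 ≤ supp φ C := by
  have : ((φ 0 : ℝ) : EReal) ≤ supp φ C := le_iSup₂ (f := fun x (_ : x ∈ C) => ((φ x : ℝ) : EReal)) 0 h0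
  simpa using this

theorem le_supp {C : Set X} {x : X} (hx : x ∈ C) (φ : StrongDual ℝ X) :
    ((φ x : ℝ) : EReal) ≤ supp φ C :=
  le_iSup₂ (f := fun x (_ : x ∈ C) => ((φ x : ℝ) : EReal)) x hx

theorem supp_le {C : Set X} {φ : StrongDual ℝ X} {c : EReal}
    (h : ∀ x ∈ C, ((φ x : ℝ) : EReal) ≤ c) : supp φ C ≤ c :=
  iSup₂_le h

theorem supp_ne_bot {C : Set X} (h : C.Nonempty) (φ : StrongDual ℝ X) : supp φ C ≠ ⊥ := by
  obtain ⟨x, hx⟩ := h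
  exact ((EReal.bot_lt_coe _).trans_le (le_supp hx φ)).ne'

theorem le_toReal_supp {C : Set X} {x : X} (hx : x ∈ C) {φ : StrongDual ℝ X}
    (h : supp φ C ≠ ⊤) : φ x ≤ (supp φ C).toReal := by
  have h1 := le_supp hx φ
  rw [← EReal.coe_toReal h (supp_ne_bot ⟨x, hx⟩ φ)] at h1
  exact_mod_cast h1

theorem toReal_supp_le {C : Set X} (hC : C.Nonempty) {φ : StrongDual ℝ X} {c : ℝ}
    (h : ∀ x ∈ C, φ x ≤ c) : (supp φ C).toReal ≤ c := by
  have h1 : supp φ C ≤ c := supp_le fun x hx => by exact_mod_cast h x hx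
  have h2 : supp φ C ≠ ⊤ := (h1.trans_lt (EReal.coe_lt_top c)).ne
  rw [← EReal.coe_toReal h2 (supp_ne_bot hC φ)] at h1
  exact_mod_cast h1

/-! ### Integrals of support functions as functions of the functional -/

variable {G : ℝ → Set X}

theorem suppFun_nonneg {t : ℝ} (h0 : 0 ∈ G t) (φ : StrongDual ℝ X) : 0 ≤ suppFun G φ t :=
  EReal.toReal_nonneg (supp_nonneg h0 φ)

/-- The integral of the support function of `G` over `A`. -/
def suppIntegral (G : ℝ → Set X) (A : Set ℝ) (φ : StrongDual ℝ X) : ℝ :=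
  ∫ t in A, suppFun G φ t

theorem ae_restrict_of_subset {A : Set ℝ} (hA : A ⊆ Icc 0 1) {P : ℝ → Prop}
    (h : ∀ᵐ t ∂volume.restrict (Icc (0 : ℝ) 1), P t) : ∀ᵐ t ∂volume.restrict A, P t :=
  ae_mono (Measure.restrict_mono_set _ hA) h

theorem ae_suppFun_nonneg (hG : ∀ t ∈ Icc (0 : ℝ) 1, 0 ∈ G t) (φ : StrongDual ℝ X) :
    ∀ᵐ t ∂volume.restrict (Icc (0 : ℝ) 1), 0 ≤ suppFun G φ t := by
  filter_upwards [ae_restrict_mem measurableSet_Icc] with t ht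
  exact suppFun_nonneg (hG t ht) φ

theorem ae_suppFun_midpoint_le (hG : ∀ t ∈ Icc (0 : ℝ) 1, 0 ∈ G t) (hS : ScalarlyIntegrable G)
    (a b : ℝ) (ha : 0 ≤ a) (hb : 0 ≤ b) (φ ψ : StrongDual ℝ X) :
    ∀ᵐ t ∂volume.restrict (Icc (0 : ℝ) 1),
      suppFun G (a • φ + b • ψ) t ≤ a * suppFun G φ t + b * suppFun G ψ t := by
  filter_upwards [(hS φ).1, (hS ψ).1, ae_restrict_mem measurableSet_Icc] with t h1 h2 ht
  refine toReal_supp_le ⟨0, hG t ht⟩ fun x hx => ?_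
  have h3 := le_toReal_supp hx h1.1
  have h4 := le_toReal_supp hx h2.1
  simp only [add_apply, smul_apply, smul_eq_mul]
  exact add_le_add (mul_le_mul_of_nonneg_left h3 ha) (mul_le_mul_of_nonneg_left h4 hb)

variable {A : Set ℝ}

theorem suppIntegral_nonneg (hG : ∀ t ∈ Icc (0 : ℝ) 1, 0 ∈ G t) (hA : A ⊆ Icc 0 1)
    (φ : StrongDual ℝ X) : 0 ≤ suppIntegral G A φ :=
  integral_nonneg_of_ae (ae_restrict_of_subset hA (ae_suppFun_nonneg hG φ))

theorem suppIntegral_le (hG : ∀ t ∈ Icc (0 : ℝ) 1, 0 ∈ G t) (hS : ScalarlyIntegrable G)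
    (hA : A ⊆ Icc 0 1) (φ : StrongDual ℝ X) :
    suppIntegral G A φ ≤ suppIntegral G (Icc 0 1) φ :=
  setIntegral_mono_set (hS φ).2 (ae_suppFun_nonneg hG φ) (Eventually.of_forall hA)

theorem suppIntegral_combo_le (hG : ∀ t ∈ Icc (0 : ℝ) 1, 0 ∈ G t) (hS : ScalarlyIntegrable G)
    (hA : A ⊆ Icc 0 1) {a b : ℝ} (ha : 0 ≤ a) (hb : 0 ≤ b) (φ ψ : StrongDual ℝ X) :
    suppIntegral G A (a • φ + b • ψ) ≤ a * suppIntegral G A φ + b * suppIntegral G A ψ := by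
  have i1 := (((hS φ).2.mono_set hA).const_mul a)
  have i2 := (((hS ψ).2.mono_set hA).const_mul b)
  simp only [suppIntegral]
  rw [← integral_const_mul, ← integral_const_mul, ← integral_add i1 i2]
  exact integral_mono_ae ((hS _).2.mono_set hA) (i1.add i2)
    (ae_restrict_of_subset hA (ae_suppFun_midpoint_le hG hS a b ha hb φ ψ))

theorem suppIntegral_smul (hG : ∀ t ∈ Icc (0 : ℝ) 1, 0 ∈ G t) (hS : ScalarlyIntegrable G)
    (hA : A ⊆ Icc 0 1) {c : ℝ} (hc : 0 ≤ c) (φ : StrongDual ℝ X) :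
    suppIntegral G A (c • φ) = c * suppIntegral G A φ := by
  have h : ∀ (d : ℝ) (ψ : StrongDual ℝ X), 0 ≤ d →
      suppIntegral G A (d • ψ) ≤ d * suppIntegral G A ψ := fun d ψ hd => by
    simpa using suppIntegral_combo_le hG hS hA hd le_rfl ψ 0
  refine le_antisymm (h c φ hc) ?_
  rcases hc.eq_or_lt with rfl | hc
  · simpa using suppIntegral_nonneg hG hA (0 : StrongDual ℝ X)
  · have h1 := h c⁻¹ (c • φ) (by positivity)
    rw [smul_smul, inv_mul_cancel₀ hc.ne', one_smul] at h1
    have h2 := mul_le_mul_of_nonneg_left h1 hc.le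
    rwa [← mul_assoc, mul_inv_cancel₀ hc.ne', one_mul] at h2

/-! ### Weak* closed sublevel sets and the extension from intervals to measurable sets -/

/-- The integral of `s(·, G)` over every interval is a supremum of evaluations. -/
def IntervalRepresentable (G : ℝ → Set X) : Prop :=
  ∀ a b : ℝ, 0 ≤ a → a < b → b ≤ 1 → ∀ (φ : StrongDual ℝ X) (r : ℝ),
    r < suppIntegral G (Icc a b) φ →
      ∃ x : X, (∀ ψ, ψ x ≤ suppIntegral G (Icc a b) ψ) ∧ r < φ x

/-- If `r = 0` then `g n → ∞` and the right side is `∞`. Otherwise `g n` has the limit `-2 * log r`,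
and `ψ n x ≤ g n` passes to the limit along `U` for each `x ∈ G t`. The functionals need to converge
only along the ultrafilter, the numbers `g n` along the whole sequence. -/
theorem ofReal_suppFun_le_liminf {t : ℝ} (h0 : 0 ∈ G t) {ψ : ℕ → StrongDual ℝ X}
    {χ : StrongDual ℝ X} {U : Ultrafilter ℕ} (hU : (U : Filter ℕ) ≤ atTop)
    (hχ : ∀ x, Tendsto (fun n => ψ n x) U (𝓝 (χ x))) {g : ℕ → ℝ} {r : ℝ}
    (hg : ∀ n, ∀ x ∈ G t, ψ n x ≤ g n)
    (hr : Tendsto (fun n => Real.exp (-(g n / 2))) atTop (𝓝 r)) :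
    ENNReal.ofReal (suppFun G χ t) ≤ liminf (fun n => ENNReal.ofReal (g n)) atTop := by
  have hr0 : 0 ≤ r := ge_of_tendsto' hr fun n => (Real.exp_pos _).le
  rcases hr0.eq_or_lt with rfl | hr0
  · have h1 : Tendsto (fun n => -(g n / 2)) atTop atBot := Real.tendsto_exp_comp_nhds_zero.1 hr
    have h2 : Tendsto g atTop atTop := by
      have := (tendsto_neg_atBot_atTop.comp h1).const_mul_atTop (two_pos : (0 : ℝ) < 2)
      refine this.congr fun n => ?_
      simp only [Function.comp_apply, neg_neg]
      ring
    have h3 := (ENNReal.tendsto_ofReal_atTop.comp h2).liminf_eq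
    simp only [Function.comp_def] at h3
    rw [h3]
    exact le_top
  · have h1 : Tendsto g atTop (𝓝 (-2 * Real.log r)) := by
      refine ((hr.log hr0.ne').const_mul (-2)).congr fun n => ?_
      rw [Real.log_exp]; ring
    have h3 := ((ENNReal.continuous_ofReal.tendsto _).comp h1).liminf_eq
    simp only [Function.comp_def] at h3
    rw [h3]
    refine ENNReal.ofReal_le_ofReal (toReal_supp_le ⟨0, h0⟩ fun x hx => ?_)
    exact le_of_tendsto_of_tendsto' (hχ x) (h1.mono_left hU) fun n => hg n x hx

/-- For each rational interval `I` and each `k`, a point `x j` with `φ x j ≤ ∫_I s(φ, G)` for all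
`φ` attains this bound at `φ₀` up to `1 / (k + 1)`. The elements of `K` that are almost as large as
`φ₀` at the first `n` of these points form a nonempty convex set `V n`. A cluster point `χ` of
suitable `ψ n ∈ V n` has `∫_I s(φ₀, G) ≤ ∫_I s(χ, G)` for all rational `I`, hence `s(φ₀, G) ≤ s(χ,
G)` almost everywhere; Fatou's lemma gives `∫_A s(χ, G) ≤ c`. -/
theorem suppIntegral_le_of_mem_closure (hG : ∀ t ∈ Icc (0 : ℝ) 1, 0 ∈ G t)
    (hS : ScalarlyIntegrable G) (hR : IntervalRepresentable G) (hA : A ⊆ Icc 0 1)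
    {c : ℝ} {φ₀ : WeakDual ℝ X}
    (hφ₀ : φ₀ ∈ closure {φ : WeakDual ℝ X | ‖WeakDual.toStrongDual φ‖ ≤ 1 ∧
      suppIntegral G A (WeakDual.toStrongDual φ) ≤ c}) :
    suppIntegral G A (WeakDual.toStrongDual φ₀) ≤ c := by
  set K : Set (WeakDual ℝ X) := {φ : WeakDual ℝ X | ‖WeakDual.toStrongDual φ‖ ≤ 1 ∧
      suppIntegral G A (WeakDual.toStrongDual φ) ≤ c} with hK
  set μ := volume.restrict A with hμ
  have hfin : IsFiniteMeasure μ :=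
    ⟨by
      rw [hμ, Measure.restrict_apply_univ]
      exact (measure_mono hA).trans_lt (by simp)⟩
  -- testing points for rational intervals
  have hx : ∀ j : ℚ × ℚ × ℕ, ∃ x : X, (0 : ℝ) ≤ j.1 → (j.1 : ℝ) < j.2.1 → (j.2.1 : ℝ) ≤ 1 →
      (∀ ψ, ψ x ≤ suppIntegral G (Icc (j.1 : ℝ) j.2.1) ψ) ∧
        suppIntegral G (Icc (j.1 : ℝ) j.2.1) (WeakDual.toStrongDual φ₀) - 1 / ((j.2.2 : ℝ) + 1)
          < φ₀ x := fun j => by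
    by_cases h : (0 : ℝ) ≤ j.1 ∧ (j.1 : ℝ) < j.2.1 ∧ (j.2.1 : ℝ) ≤ 1
    · obtain ⟨x, hx⟩ := hR j.1 j.2.1 h.1 h.2.1 h.2.2 (WeakDual.toStrongDual φ₀) _
        (sub_lt_self _ (show (0 : ℝ) < 1 / ((j.2.2 : ℝ) + 1) by positivity))
      exact ⟨x, fun _ _ _ => hx⟩
    · exact ⟨0, fun h1 h2 h3 => absurd ⟨h1, h2, h3⟩ h⟩
  choose x hx using hx
  set V : ℕ → Set (WeakDual ℝ X) := fun n => {ψ | ψ ∈ K ∧ ∀ j : ℚ × ℚ × ℕ, Encodable.encode j ≤ n →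
    φ₀ (x j) - 1 / ((j.2.2 : ℝ) + 1) ≤ ψ (x j)} with hV
  have hVanti : Antitone V := fun n m hnm ψ hψ => ⟨hψ.1, fun j hj => hψ.2 j (hj.trans hnm)⟩
  have hVne : ∀ n, (V n).Nonempty := fun n => by
    have hfinj : {j : ℚ × ℚ × ℕ | Encodable.encode j ≤ n}.Finite :=
      (finite_Iic n).preimage Encodable.encode_injective.injOn
    have hopen : IsOpen (⋂ j ∈ {j : ℚ × ℚ × ℕ | Encodable.encode j ≤ n},
        {ψ : WeakDual ℝ X | φ₀ (x j) - 1 / ((j.2.2 : ℝ) + 1) < ψ (x j)}) :=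
      hfinj.isOpen_biInter fun j _ => isOpen_lt continuous_const (WeakDual.eval_continuous _)
    obtain ⟨ψ, hψ, hψK⟩ := mem_closure_iff.1 hφ₀ _ hopen (by
      simp only [mem_iInter, mem_ofPred_eq]
      exact fun j _ => sub_lt_self _ (by positivity))
    simp only [mem_iInter, mem_ofPred_eq] at hψ
    exact ⟨ψ, hψK, fun j hj => (hψ j hj).le⟩
  have hSA : ∀ ψ : StrongDual ℝ X, Integrable (suppFun G ψ) μ := fun ψ => (hS ψ).2.mono_set hA
  -- Averages of support functions `s(ψ, G)` only dominate the support function at the averaged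
  -- functional. Passing to all integrable dominants with integral at most `c` makes the family
  -- midpoint convex.
  set C : ℕ → Set (ℝ → ℝ) := fun n => {g | ∃ ψ ∈ V n, Integrable g μ ∧
    (∀ᵐ t ∂μ, suppFun G (WeakDual.toStrongDual ψ) t ≤ g t) ∧ ∫ t, g t ∂μ ≤ c} with hC
  obtain ⟨g, r, hgC, hgr⟩ := exists_seq_tendsto_exp_neg μ C
    (fun n m hnm g ⟨ψ, hψ, h⟩ => ⟨ψ, hVanti hnm hψ, h⟩)
    (fun n => by
      obtain ⟨ψ, hψ⟩ := hVne n
      exact ⟨_, ψ, hψ, hSA _, Eventually.of_forall fun t => le_rfl, hψ.1.2⟩)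
    (fun n g ⟨ψ, hψ, h, _⟩ => h.aemeasurable)
    (fun n g ⟨ψ, hψ, _, h, _⟩ => by
      filter_upwards [h, ae_restrict_of_subset hA (ae_suppFun_nonneg hG
        (WeakDual.toStrongDual ψ))] with t h1 h2
      exact h2.trans h1)
    (by
      rintro n g ⟨ψ, hψ, h1, h2, h3⟩ g' ⟨ψ', hψ', h1', h2', h3'⟩
      have hle := ae_restrict_of_subset hA (ae_suppFun_midpoint_le hG hS (1 / 2) (1 / 2)
        (by norm_num) (by norm_num) (WeakDual.toStrongDual ψ) (WeakDual.toStrongDual ψ'))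
      have hae : ∀ᵐ t ∂μ, suppFun G (WeakDual.toStrongDual
          ((1 / 2 : ℝ) • ψ + (1 / 2 : ℝ) • ψ')) t ≤ (g t + g' t) / 2 := by
        filter_upwards [hle, h2, h2'] with t a1 a2 a3
        rw [map_add, map_smul, map_smul]
        linarith
      have hint : ∫ t, (g t + g' t) / 2 ∂μ ≤ c := by
        rw [integral_div, integral_add h1 h1']
        linarith
      have hintg : Integrable (fun t => (g t + g' t) / 2) μ := (h1.add h1').div_const 2
      refine ⟨(1 / 2 : ℝ) • ψ + (1 / 2 : ℝ) • ψ', ⟨⟨?_, ?_⟩, fun j hj => ?_⟩, hintg, hae, hint⟩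
      · rw [map_add, map_smul, map_smul]
        refine (norm_add_le _ _).trans ?_
        rw [norm_smul, norm_smul, Real.norm_of_nonneg (by norm_num)]
        linarith [hψ.1.1, hψ'.1.1]
      · exact (integral_mono_ae (hSA _) hintg hae).trans hint
      · have a1 := hψ.2 j hj
        have a2 := hψ'.2 j hj
        have e : ((1 / 2 : ℝ) • ψ + (1 / 2 : ℝ) • ψ') (x j) =
          (1 / 2 : ℝ) * ψ (x j) + (1 / 2 : ℝ) * ψ' (x j) := rfl
        rw [e]
        linarith)
  choose ψ hψV hgi hψg hgc using hgC
  -- a cluster point of the sequence of functionals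
  set U : Ultrafilter ℕ := hyperfilter ℕ with hUdef
  have hU : (U : Filter ℕ) ≤ atTop := by
    rw [← Nat.cofinite_eq_atTop]; exact hyperfilter_le_cofinite
  obtain ⟨χ, -, hχ⟩ := (WeakDual.isCompact_closedBall (𝕜 := ℝ) (0 : StrongDual ℝ X)
    1).ultrafilter_le_nhds (U.map ψ) (by
      rw [Ultrafilter.coe_map, le_principal_iff, mem_map]
      refine Filter.univ_mem' fun n => ?_
      simpa using (hψV n).1.1)
  have hχ' : ∀ y : X, Tendsto (fun n => ψ n y) U (𝓝 (χ y)) := fun y =>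
    ((WeakDual.eval_continuous y).tendsto χ).comp hχ
  have hχx : ∀ j, φ₀ (x j) - 1 / ((j.2.2 : ℝ) + 1) ≤ χ (x j) := fun j =>
    ge_of_tendsto (hχ' (x j)) (hU (by
      filter_upwards [eventually_ge_atTop (Encodable.encode j)] with n hn
      exact (hψV n).2 j hn))
  -- One error `1 / (k + 1)` comes from the choice of `x j`, another from the definition of `V n`.
  have hcomp : ∀ᵐ t ∂volume.restrict (Icc (0 : ℝ) 1),
      suppFun G (WeakDual.toStrongDual φ₀) t ≤ suppFun G (WeakDual.toStrongDual χ) t := by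
    refine ae_le_of_forall_rat_setIntegral_le (hS _).2 (hS _).2 fun a b ha hab hb => ?_
    have hlim : Tendsto (fun k : ℕ => suppIntegral G (Icc (a : ℝ) b) (WeakDual.toStrongDual φ₀) -
        2 * (1 / ((k : ℝ) + 1))) atTop
        (𝓝 (suppIntegral G (Icc (a : ℝ) b) (WeakDual.toStrongDual φ₀) - 2 * 0)) :=
      (tendsto_one_div_add_atTop_nhds_zero_nat.const_mul 2).const_sub _
    rw [mul_zero, sub_zero] at hlim
    refine le_of_tendsto' hlim fun k => ?_
    obtain ⟨h1, h2⟩ := hx (a, b, k) ha hab hb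
    have h3 := h1 (WeakDual.toStrongDual χ)
    have h4 := hχx (a, b, k)
    have h5 : WeakDual.toStrongDual χ (x (a, b, k)) = χ (x (a, b, k)) := rfl
    rw [h5] at h3
    simp only [suppIntegral] at h2 h3 ⊢
    linarith
  have hfatou : ENNReal.ofReal (∫ t, suppFun G (WeakDual.toStrongDual χ) t ∂μ) ≤
      ENNReal.ofReal c := by
    rw [ofReal_integral_eq_lintegral_ofReal (hSA _)
      (ae_restrict_of_subset hA (ae_suppFun_nonneg hG _))]
    calc ∫⁻ t, ENNReal.ofReal (suppFun G (WeakDual.toStrongDual χ) t) ∂μ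
        ≤ ∫⁻ t, liminf (fun n => ENNReal.ofReal (g n t)) atTop ∂μ := by
          refine lintegral_mono_ae ?_
          have hall : ∀ᵐ t ∂μ, ∀ n, suppFun G (WeakDual.toStrongDual (ψ n)) t ≤ g n t ∧
              supp (WeakDual.toStrongDual (ψ n)) (G t) ≠ ⊤ := ae_all_iff.2 fun n => by
            filter_upwards [hψg n, ae_restrict_of_subset hA (hS (WeakDual.toStrongDual (ψ n))).1]
              with t h1 h2
            exact ⟨h1, h2.1⟩
          filter_upwards [hall, hgr, ae_restrict_of_subset hA (ae_restrict_mem measurableSet_Icc)]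
            with t h1 h2 h3
          exact ofReal_suppFun_le_liminf (hG t h3) hU hχ'
            (fun n y hy => (le_toReal_supp hy (h1 n).2).trans (h1 n).1) h2
      _ ≤ liminf (fun n => ∫⁻ t, ENNReal.ofReal (g n t) ∂μ) atTop :=
          lintegral_liminf_le' fun n => (hgi n).aemeasurable.ennreal_ofReal
      _ ≤ ENNReal.ofReal c := by
          refine liminf_le_of_frequently_le' (Frequently.of_forall fun n => ?_)
          rw [← ofReal_integral_eq_lintegral_ofReal (hgi n) (by
            filter_upwards [hψg n, ae_restrict_of_subset hA (ae_suppFun_nonneg hG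
              (WeakDual.toStrongDual (ψ n)))] with t h1 h2
            exact h2.trans h1)]
          exact ENNReal.ofReal_le_ofReal (hgc n)
  have hc0 : 0 ≤ c := (suppIntegral_nonneg hG hA _).trans (hψV 0).1.2
  have h1 : suppIntegral G A (WeakDual.toStrongDual χ) ≤ c := (ENNReal.ofReal_le_ofReal_iff hc0).1 hfatou
  exact (integral_mono_ae (hSA _) (hSA _) (ae_restrict_of_subset hA hcomp)).trans h1

theorem isClosed_suppIntegral_sublevel (hG : ∀ t ∈ Icc (0 : ℝ) 1, 0 ∈ G t)
    (hS : ScalarlyIntegrable G) (hR : IntervalRepresentable G) (hA : A ⊆ Icc 0 1)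
    (c : ℝ) :
    IsClosed {φ : WeakDual ℝ X | ‖WeakDual.toStrongDual φ‖ ≤ 1 ∧
      suppIntegral G A (WeakDual.toStrongDual φ) ≤ c} := by
  refine isClosed_of_closure_subset fun φ hφ => ⟨?_, suppIntegral_le_of_mem_closure hG hS hR hA hφ⟩
  have h1 : IsClosed (WeakDual.toStrongDual ⁻¹' Metric.closedBall (0 : StrongDual ℝ X) 1) :=
    WeakDual.isClosed_closedBall 0 1
  have h2 := closure_minimal (s := {φ : WeakDual ℝ X | ‖WeakDual.toStrongDual φ‖ ≤ 1 ∧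
      suppIntegral G A (WeakDual.toStrongDual φ) ≤ c}) (fun ψ hψ => by simpa using hψ.1) h1 hφ
  simpa using h2

/-- **Extension from intervals to measurable sets.** If `G` is scalarly integrable, `0 ∈ G t` for
all `t`, and the integrals of `s(·, G)` over intervals are support functions of bounded sets, then
`G` is Pettis integrable. -/
theorem pettisIntegrableIn_of_intervals [CompleteSpace X] (hG : ∀ t ∈ Icc (0 : ℝ) 1, 0 ∈ G t)
    (hS : ScalarlyIntegrable G)
    (hN : ∀ a b : ℝ, 0 ≤ a → a < b → b ≤ 1 → ∃ N : Set X, Bornology.IsBounded N ∧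
      ∀ φ : StrongDual ℝ X, supp φ N = (suppIntegral G (Icc a b) φ : EReal)) :
    PettisIntegrableIn (closedConvexBounded X) G := by
  have hR : IntervalRepresentable G := fun a b ha hab hb φ r hr => by
    obtain ⟨N, -, hN⟩ := hN a b ha hab hb
    have h1 : (r : EReal) < supp φ N := by rw [hN φ]; exact_mod_cast hr
    obtain ⟨x, hx⟩ := lt_iSup_iff.1 h1
    obtain ⟨hxN, hx⟩ := lt_iSup_iff.1 hx
    refine ⟨x, fun ψ => ?_, by exact_mod_cast hx⟩
    have := le_supp hxN ψ
    rw [hN ψ] at this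
    exact_mod_cast this
  obtain ⟨N, hNb, hN⟩ := hN 0 1 le_rfl one_pos le_rfl
  obtain ⟨B, hB0, hB⟩ := hNb.exists_pos_norm_le
  have hbound : ∀ φ : StrongDual ℝ X, suppIntegral G (Icc 0 1) φ ≤ B * ‖φ‖ := fun φ => by
    have h1 : supp φ N ≤ ((B * ‖φ‖ : ℝ) : EReal) := supp_le fun x hx => by
      have h2 := (le_abs_self _).trans (φ.le_opNorm x)
      have h3 : ‖φ‖ * ‖x‖ ≤ ‖φ‖ * B := by gcongr; exact hB x hx
      have : φ x ≤ B * ‖φ‖ := by linarith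
      exact_mod_cast this
    rw [hN φ] at h1
    exact_mod_cast h1
  refine ⟨hS, fun A hA hAm => ?_⟩
  have hp : IsBallLscSublinear (suppIntegral G A) B :=
    ⟨fun φ ψ => by simpa using suppIntegral_combo_le hG hS hA zero_le_one zero_le_one φ ψ,
      fun c φ hc => suppIntegral_smul hG hS hA hc φ,
      fun φ => (suppIntegral_le hG hS hA φ).trans (hbound φ),
      isClosed_suppIntegral_sublevel hG hS hR hA⟩
  -- The largest candidate for `M(A)`: all points dominated by `φ ↦ ∫_A s(φ, G)`. That its support
  -- function is not smaller than this integral is `exists_eval_gt`.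
  refine ⟨{x | ∀ φ : StrongDual ℝ X, φ x ≤ suppIntegral G A φ}, ⟨⟨⟨0, fun φ => ?_⟩, ?_, ?_⟩, ?_⟩,
    fun φ => le_antisymm (supp_le fun x hx => by exact_mod_cast hx φ) ?_⟩
  · simpa using suppIntegral_nonneg hG hA φ
  · rw [show {x : X | ∀ φ : StrongDual ℝ X, φ x ≤ suppIntegral G A φ} =
      ⋂ φ : StrongDual ℝ X, {x | φ x ≤ suppIntegral G A φ} by ext; simp]
    exact isClosed_iInter fun φ => isClosed_le φ.continuous continuous_const
  · intro x hx y hy a b ha hb hab φ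
    rw [map_add, map_smul, map_smul, smul_eq_mul, smul_eq_mul]
    calc a * φ x + b * φ y ≤ a * suppIntegral G A φ + b * suppIntegral G A φ := by
          gcongr
          exacts [hx φ, hy φ]
      _ = suppIntegral G A φ := by rw [← add_mul, hab, one_mul]
  · refine isBounded_iff_forall_norm_le.2 ⟨B, fun x hx => ?_⟩
    have := norm_sub_le_of_forall (x := 0) (y := x) (c := B) fun φ hφ => by
      have h1 := (hx φ).trans (hp.le_norm φ)
      rw [map_zero, zero_add]
      nlinarith
    simpa using this
  · by_contra! hlt
    obtain ⟨r, hr1, hr2⟩ := EReal.lt_iff_exists_real_btwn.1 hlt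
    obtain ⟨x, hx, hxr⟩ := hp.exists_eval_gt hB0.le (φ₀ := φ) (r := r) (by exact_mod_cast hr2)
    have h1 := le_supp (C := {x | ∀ φ : StrongDual ℝ X, φ x ≤ suppIntegral G A φ}) hx φ
    exact absurd (h1.trans_lt hr1) (not_lt.2 (by exact_mod_cast hxr.le))

end Extension

/-! ### Approximate derivatives -/

theorem isDensityPoint_univ (x : ℝ) : IsDensityPoint univ x := by
  refine tendsto_const_nhds.congr' ?_
  filter_upwards [self_mem_nhdsWithin] with h hh
  have hh : 0 < h := hh
  rw [univ_inter, Real.volume_Ioo, ENNReal.toReal_ofReal (by linarith)]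
  field_simp
  ring

theorem volume_inter_Ioo_toReal_le (E : Set ℝ) (x : ℝ) {h : ℝ} (hh : 0 < h) :
    (volume (E ∩ Ioo (x - h) (x + h))).toReal ≤ 2 * h := by
  have h1 : volume (E ∩ Ioo (x - h) (x + h)) ≤ ENNReal.ofReal (2 * h) := by
    refine (measure_mono inter_subset_right).trans (le_of_eq ?_)
    rw [Real.volume_Ioo]; congr 1; ring
  exact ENNReal.toReal_le_of_le_ofReal (by linarith) h1

/-- Inclusion-exclusion inside `(x - h, x + h)`: the union has measure at most `2 * h`, so the
relative measure of the intersection is at least the sum of the two minus `1`. -/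
theorem IsDensityPoint.inter {E E' : Set ℝ} {x : ℝ} (h : IsDensityPoint E x)
    (h' : IsDensityPoint E' x) (hE' : NullMeasurableSet E' volume) :
    IsDensityPoint (E ∩ E') x := by
  have hlow := (h.add h').sub_const 1
  rw [add_sub_cancel_right] at hlow
  refine tendsto_of_tendsto_of_tendsto_of_le_of_le' hlow tendsto_const_nhds ?_ ?_
  · filter_upwards [self_mem_nhdsWithin] with h hh
    have hh : 0 < h := hh
    have hne : ∀ s : Set ℝ, volume (s ∩ Ioo (x - h) (x + h)) ≠ ⊤ := fun s =>
      ((measure_mono inter_subset_right).trans_lt (by simp)).ne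
    have h1 := measure_union_add_inter₀ (μ := volume) (E ∩ Ioo (x - h) (x + h))
      (hE'.inter (measurableSet_Ioo (a := x - h) (b := x + h)).nullMeasurableSet)
    rw [← union_inter_distrib_right, ← inter_inter_distrib_right] at h1
    have h2 := congrArg ENNReal.toReal h1
    rw [ENNReal.toReal_add (hne _) (hne _), ENNReal.toReal_add (hne _) (hne _)] at h2
    have h3 := volume_inter_Ioo_toReal_le (E ∪ E') x hh
    rw [← add_div, sub_le_iff_le_add, div_add_one (by positivity)]
    exact div_le_div_of_nonneg_right (by linarith) (by linarith)
  · filter_upwards [self_mem_nhdsWithin] with h hh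
    have hh : 0 < h := hh
    exact div_le_one_of_le₀ (volume_inter_Ioo_toReal_le _ x hh) (by linarith)

/-- A set that misses a right neighbourhood of `x` has relative measure at most `1 / 2` in small
symmetric intervals. -/
theorem IsDensityPoint.neBot_right {E : Set ℝ} {x : ℝ} (h : IsDensityPoint E x) :
    (𝓝[E ∩ Ioi x] x).NeBot := by
  rw [← mem_closure_iff_nhdsWithin_neBot, Metric.mem_closure_iff]
  intro δ hδ
  by_contra! hno
  have hle : ∀ᶠ h in 𝓝[>] (0 : ℝ),
      (volume (E ∩ Ioo (x - h) (x + h))).toReal / (2 * h) ≤ 1 / 2 := by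
    filter_upwards [Ioo_mem_nhdsGT hδ] with h hh
    have hsub : E ∩ Ioo (x - h) (x + h) ⊆ Icc (x - h) x := by
      rintro y ⟨hyE, hy1, hy2⟩
      refine ⟨hy1.le, ?_⟩
      by_contra! hxy
      have := hno y ⟨hyE, hxy⟩
      rw [dist_comm, Real.dist_eq, abs_of_pos (sub_pos.2 hxy)] at this
      linarith [hh.2]
    have h1 : (volume (E ∩ Ioo (x - h) (x + h))).toReal ≤ h := by
      refine ENNReal.toReal_le_of_le_ofReal hh.1.le ((measure_mono hsub).trans (le_of_eq ?_))
      rw [Real.volume_Icc]; congr 1; ring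
    rw [div_le_div_iff₀ (by linarith [hh.1]) two_pos]
    linarith
  have := le_of_tendsto h hle
  norm_num at this

theorem HasDerivAt.hasApproxDerivAt {F : ℝ → ℝ} {v x : ℝ} (h : HasDerivAt F v x) :
    HasApproxDerivAt F v x :=
  ⟨univ, MeasurableSet.univ.nullMeasurableSet, isDensityPoint_univ x, h.hasDerivWithinAt⟩

namespace HasApproxDerivAt

variable {F H : ℝ → ℝ} {v w x : ℝ}

theorem add (hF : HasApproxDerivAt F v x) (hH : HasApproxDerivAt H w x) :
    HasApproxDerivAt (fun y => F y + H y) (v + w) x := by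
  obtain ⟨E, hE, hEx, hFE⟩ := hF
  obtain ⟨E', hE', hEx', hHE⟩ := hH
  exact ⟨E ∩ E', hE.inter hE', hEx.inter hEx' hE',
    (hFE.mono inter_subset_left).add (hHE.mono inter_subset_right)⟩

theorem neg (hF : HasApproxDerivAt F v x) : HasApproxDerivAt (fun y => -F y) (-v) x := by
  obtain ⟨E, hE, hEx, hFE⟩ := hF
  exact ⟨E, hE, hEx, hFE.neg⟩

theorem exists_tendsto_slope_right (hF : HasApproxDerivAt F v x) :
    ∃ l : Filter ℝ, l.NeBot ∧ l ≤ 𝓝[>] x ∧ Tendsto (slope F x) l (𝓝 v) := by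
  obtain ⟨E, -, hEx, hFE⟩ := hF
  refine ⟨𝓝[E ∩ Ioi x] x, hEx.neBot_right, nhdsWithin_mono x inter_subset_right, ?_⟩
  exact (hasDerivWithinAt_iff_tendsto_slope' fun h => lt_irrefl x h.2).1 (hFE.mono inter_subset_left)

theorem eq_of_hasDerivAt (hF : HasApproxDerivAt F v x) (h : HasDerivAt F w x) : v = w := by
  obtain ⟨l, hl, hlx, hv⟩ := hF.exists_tendsto_slope_right
  refine tendsto_nhds_unique hv (Tendsto.mono_left ?_ hlx)
  exact (hasDerivWithinAt_iff_tendsto_slope' self_notMem_Ioi).1 h.hasDerivWithinAt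

end HasApproxDerivAt

/-! ### Functions that are AC on a set -/

namespace ACOn

variable {F H : ℝ → ℝ} {E E' : Set ℝ}

theorem mono (h : ACOn F E) (hE : E' ⊆ E) : ACOn F E' := fun ε hε => by
  obtain ⟨δ, hδ, h⟩ := h ε hε
  exact ⟨δ, hδ, fun n c d hcd => h n c d fun i => ⟨hE (hcd i).1, hE (hcd i).2.1, (hcd i).2.2⟩⟩

theorem add (hF : ACOn F E) (hH : ACOn H E) : ACOn (fun x => F x + H x) E := fun ε hε => by
  obtain ⟨δ, hδ, hF⟩ := hF (ε / 2) (half_pos hε)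
  obtain ⟨δ', hδ', hH⟩ := hH (ε / 2) (half_pos hε)
  refine ⟨min δ δ', lt_min hδ hδ', fun n c d hcd hdisj hlt => ?_⟩
  have h1 := hF n c d hcd hdisj (hlt.trans_le (min_le_left _ _))
  have h2 := hH n c d hcd hdisj (hlt.trans_le (min_le_right _ _))
  calc ∑ i, |F (d i) + H (d i) - (F (c i) + H (c i))|
      ≤ ∑ i, (|F (d i) - F (c i)| + |H (d i) - H (c i)|) :=
        Finset.sum_le_sum fun i _ => by rw [add_sub_add_comm]; exact abs_add_le _ _
    _ < ε := by rw [Finset.sum_add_distrib]; linarith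

theorem neg (hF : ACOn F E) : ACOn (fun x => -F x) E := fun ε hε => by
  obtain ⟨δ, hδ, hF⟩ := hF ε hε
  refine ⟨δ, hδ, fun n c d hcd hdisj hlt => ?_⟩
  simpa only [neg_sub_neg, abs_sub_comm] using hF n c d hcd hdisj hlt

theorem const_mul_id {e : ℝ} (he : 0 < e) (E : Set ℝ) : ACOn (fun x => e * x) E := fun ε hε => by
  refine ⟨ε / e, div_pos hε he, fun n c d hcd _ hlt => ?_⟩
  have : ∑ i, |e * d i - e * c i| = e * ∑ i, (d i - c i) := by
    rw [Finset.mul_sum]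
    refine Finset.sum_congr rfl fun i _ => ?_
    rw [← mul_sub, abs_of_nonneg (mul_nonneg he.le (sub_nonneg.2 (hcd i).2.2))]
  rw [this]
  rw [lt_div_iff₀ he] at hlt
  linarith

theorem exists_forall_finset (h : ACOn F E) {ε : ℝ} (hε : 0 < ε) : ∃ δ : ℝ, 0 < δ ∧
    ∀ (ι : Type) (s : Finset ι) (c d : ι → ℝ), (∀ i ∈ s, c i ∈ E ∧ d i ∈ E ∧ c i ≤ d i) →
      ((s : Set ι).Pairwise fun i j => Disjoint (Ioo (c i) (d i)) (Ioo (c j) (d j))) →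
      ∑ i ∈ s, (d i - c i) < δ → ∑ i ∈ s, |F (d i) - F (c i)| < ε := by
  obtain ⟨δ, hδ, h⟩ := h ε hε
  refine ⟨δ, hδ, fun ι s c d hcd hdisj hlt => ?_⟩
  have hsum : ∀ f : ι → ℝ, ∑ i : Fin s.card, f (s.equivFin.symm i) = ∑ i ∈ s, f i := fun f => by
    rw [Equiv.sum_comp s.equivFin.symm fun i : s => f i, Finset.sum_coe_sort s f]
  have h1 := h s.card (fun i => c (s.equivFin.symm i)) (fun i => d (s.equivFin.symm i))
    (fun i => hcd _ (s.equivFin.symm i).2)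
    (fun i j hij => hdisj (s.equivFin.symm i).2 (s.equivFin.symm j).2 fun he =>
      hij (s.equivFin.symm.injective (Subtype.ext he)))
    (by rw [hsum fun i => d i - c i]; exact hlt)
  rwa [hsum fun i => |F (d i) - F (c i)|] at h1

/-- Lusin's condition (N). -/
theorem volume_image_eq_zero {Z : Set ℝ} (h : ACOn F Z) (hZ : volume Z = 0) :
    volume (F '' Z) = 0 := by
  have key : ∀ ε : ℝ, 0 < ε → volume (F '' Z) ≤ ENNReal.ofReal (2 * ε) := fun ε hε => by
    obtain ⟨δ, hδ, h⟩ := h.exists_forall_finset hε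
    obtain ⟨U, hZU, hU, hUδ⟩ := exists_isOpen_lt_of_lt (μ := volume) Z (ENNReal.ofReal δ)
      (by rw [hZ]; exact ENNReal.ofReal_pos.2 hδ)
    -- The components of `U` are disjoint intervals of total length below `δ`. Two points of `Z`
    -- chosen in each of finitely many of them form an admissible family for the AC condition, which
    -- therefore controls the sum of the diameters of the sets `F '' (Z ∩ C)`.
    set S : Set (Set ℝ) := (connectedComponentIn U) '' U with hS
    have hSo : ∀ C ∈ S, IsOpen C := by
      rintro _ ⟨x, -, rfl⟩; exact hU.connectedComponentIn
    have hSU : ∀ C ∈ S, C ⊆ U := by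
      rintro _ ⟨x, -, rfl⟩; exact connectedComponentIn_subset U x
    have hSc : ∀ C ∈ S, OrdConnected C := by
      rintro _ ⟨x, -, rfl⟩; exact isPreconnected_connectedComponentIn.ordConnected
    have hSd : S.PairwiseDisjoint id := by
      rintro _ ⟨x, -, rfl⟩ _ ⟨y, -, rfl⟩ hne
      refine disjoint_left.2 fun z hz hz' => hne ?_
      rw [connectedComponentIn_eq hz, connectedComponentIn_eq hz']
    have hScount : S.Countable := hSd.countable_of_isOpen hSo (by
      rintro _ ⟨x, hx, rfl⟩; exact ⟨x, mem_connectedComponentIn hx⟩)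
    set m : Set ℝ → ENNReal := fun C => Metric.ediam (F '' (Z ∩ C)) with hm
    have hcover : F '' Z ⊆ ⋃ C ∈ S, F '' (Z ∩ C) := by
      rintro _ ⟨z, hz, rfl⟩
      exact mem_biUnion (mem_image_of_mem _ (hZU hz)) ⟨z, ⟨hz, mem_connectedComponentIn (hZU hz)⟩, rfl⟩
    have hfin : ∀ T : Finset (Set ℝ), (T : Set (Set ℝ)) ⊆ S → ∑ C ∈ T, m C ≤ ENNReal.ofReal (2 * ε) := by
      intro T hT
      have hlen : ∀ c d : Set ℝ → ℝ, ∀ T : Finset (Set ℝ), (T : Set (Set ℝ)) ⊆ S →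
          (∀ C ∈ T, c C ∈ Z ∩ C ∧ d C ∈ Z ∩ C ∧ c C ≤ d C) →
          ∑ C ∈ T, |F (d C) - F (c C)| < ε := by
        intro c d T hT hcd
        have hIcc : ∀ C ∈ T, Icc (c C) (d C) ⊆ C := fun C hC =>
          (hSc C (hT hC)).out (hcd C hC).1.2 (hcd C hC).2.1.2
        refine h (Set ℝ) T c d (fun C hC => ⟨(hcd C hC).1.1, (hcd C hC).2.1.1, (hcd C hC).2.2⟩) ?_ ?_
        · intro C hC D hD hne
          exact (hSd (hT hC) (hT hD) hne).mono (Ioo_subset_Icc_self.trans (hIcc C hC))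
            (Ioo_subset_Icc_self.trans (hIcc D hD))
        · have h1 : ENNReal.ofReal (∑ C ∈ T, (d C - c C)) ≤ volume U := by
            rw [ENNReal.ofReal_sum_of_nonneg fun C hC => sub_nonneg.2 (hcd C hC).2.2]
            calc ∑ C ∈ T, ENNReal.ofReal (d C - c C) ≤ ∑ C ∈ T, volume C :=
                  Finset.sum_le_sum fun C hC => by
                    rw [← Real.volume_Icc]; exact measure_mono (hIcc C hC)
              _ = volume (⋃ C ∈ T, C) := (measure_biUnion_finset
                    (fun C hC D hD hne => hSd (hT hC) (hT hD) hne)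
                    fun C hC => (hSo C (hT hC)).measurableSet).symm
              _ ≤ volume U := measure_mono (iUnion₂_subset fun C hC => hSU C (hT hC))
          exact (ENNReal.ofReal_lt_ofReal_iff hδ).1 (h1.trans_lt hUδ)
      have hmtop : ∀ C ∈ T, m C ≠ ⊤ := fun C hC => by
        refine ((Metric.ediam_le (d := ENNReal.ofReal ε) ?_).trans_lt ENNReal.ofReal_lt_top).ne
        have hle : ∀ x ∈ Z ∩ C, ∀ y ∈ Z ∩ C, x ≤ y → |F y - F x| ≤ ε := fun x hx y hy hxy => by
          have := hlen (fun _ => x) (fun _ => y) {C} (by simpa using hT hC)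
            (by simpa using ⟨hx, hy, hxy⟩)
          simpa using this.le
        rintro _ ⟨x, hx, rfl⟩ _ ⟨y, hy, rfl⟩
        rw [edist_dist, Real.dist_eq]
        refine ENNReal.ofReal_le_ofReal ?_
        rcases le_total x y with hxy | hxy
        · rw [abs_sub_comm]; exact hle x hx y hy hxy
        · exact hle y hy x hx hxy
      classical
      -- Two points of `Z ∩ C` whose images are more than half the diameter apart, whence the factor
      -- `2`. They exist because the diameter is finite and nonzero.
      have hpair : ∀ C ∈ T.filter fun C => m C ≠ 0, ∃ p : ℝ × ℝ, (p.1 ∈ Z ∩ C ∧ p.2 ∈ Z ∩ C ∧ p.1 ≤ p.2) ∧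
          m C ≤ ENNReal.ofReal (2 * |F p.2 - F p.1|) := fun C hC => by
        obtain ⟨hCT, hC0⟩ := Finset.mem_filter.1 hC
        have hhalf : m C / 2 < m C := ENNReal.half_lt_self hC0 (hmtop C hCT)
        have : ∃ x ∈ Z ∩ C, ∃ y ∈ Z ∩ C, m C / 2 < edist (F x) (F y) := by
          by_contra! hno
          refine hhalf.not_ge (Metric.ediam_le ?_)
          rintro _ ⟨x, hx, rfl⟩ _ ⟨y, hy, rfl⟩
          exact hno x hx y hy
        obtain ⟨x, hx, y, hy, hxy⟩ := this
        have hle : m C ≤ ENNReal.ofReal (2 * |F x - F y|) := by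
          rw [ENNReal.ofReal_mul two_pos.le, ENNReal.ofReal_ofNat, ← Real.dist_eq, ← edist_dist, mul_comm]
          exact (ENNReal.div_le_iff_le_mul (Or.inl two_ne_zero) (Or.inl ENNReal.ofNat_ne_top)).1 hxy.le
        rcases le_total x y with h | h
        · exact ⟨(x, y), ⟨hx, hy, h⟩, by simpa only [abs_sub_comm] using hle⟩
        · exact ⟨(y, x), ⟨hy, hx, h⟩, hle⟩
      choose! q hq hqm using hpair
      calc ∑ C ∈ T, m C = ∑ C ∈ T.filter fun C => m C ≠ 0, m C := (Finset.sum_filter_ne_zero T).symm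
        _ ≤ ∑ C ∈ T.filter fun C => m C ≠ 0, ENNReal.ofReal (2 * |F (q C).2 - F (q C).1|) :=
            Finset.sum_le_sum hqm
        _ = ENNReal.ofReal (2 * ∑ C ∈ T.filter fun C => m C ≠ 0, |F (q C).2 - F (q C).1|) := by
            rw [Finset.mul_sum, ENNReal.ofReal_sum_of_nonneg fun C _ => by positivity]
        _ ≤ ENNReal.ofReal (2 * ε) := by
            refine ENNReal.ofReal_le_ofReal ?_
            have := hlen (fun C => (q C).1) (fun C => (q C).2) (T.filter fun C => m C ≠ 0)
              (fun C hC => hT (Finset.mem_filter.1 hC).1) hq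
            linarith
    calc volume (F '' Z) ≤ volume (⋃ C ∈ S, F '' (Z ∩ C)) := measure_mono hcover
      _ ≤ ∑' C : S, volume (F '' (Z ∩ C)) := measure_biUnion_le _ hScount _
      _ ≤ ∑' C : S, m C := ENNReal.tsum_le_tsum fun C => Real.volume_le_diam _
      _ ≤ ENNReal.ofReal (2 * ε) := by
          rw [ENNReal.tsum_eq_iSup_sum]
          refine iSup_le fun T => ?_
          have := hfin (T.map (Function.Embedding.subtype _)) (by
            intro C hC
            simp only [Finset.coe_map, Function.Embedding.subtype_apply, mem_image] at hC
            obtain ⟨D, -, rfl⟩ := hC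
            exact D.2)
          simpa using this
  refine le_antisymm (ENNReal.le_of_forall_pos_le_add fun ε hε _ => ?_) zero_le
  have := key (ε / 2) (by positivity)
  rw [mul_div_cancel₀ _ two_ne_zero] at this
  simpa using this

end ACOn

theorem AbsolutelyContinuousOnInterval.acOn {F : ℝ → ℝ} {a b : ℝ} (hab : a ≤ b)
    (h : AbsolutelyContinuousOnInterval F a b) : ACOn F (Icc a b) := fun ε hε => by
  obtain ⟨δ, hδ, h⟩ := (absolutelyContinuousOnInterval_iff F a b).1 h ε hε
  refine ⟨δ, hδ, fun n c d hcd hdisj hlt => ?_⟩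
  set I : ℕ → ℝ × ℝ := fun i => if hi : i < n then (c ⟨i, hi⟩, d ⟨i, hi⟩) else (a, a) with hI
  have hIi : ∀ i : Fin n, I i = (c i, d i) := fun i => by simp [hI]
  have hdI : ∀ i : Fin n, dist (I i).1 (I i).2 = d i - c i := fun i => by
    rw [hIi, dist_comm, Real.dist_eq, abs_of_nonneg (sub_nonneg.2 (hcd i).2.2)]
  have hFI : ∀ i : Fin n, dist (F (I i).1) (F (I i).2) = |F (d i) - F (c i)| := fun i => by
    rw [hIi, dist_comm, Real.dist_eq]
  have h1 := h (n, I) ⟨?_, ?_⟩ ?_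
  · simpa only [Finset.sum_range, hFI] using h1
  · intro i hi
    have hi := Finset.mem_range.1 hi
    rw [uIcc_of_le hab]
    have := hIi ⟨i, hi⟩
    simp only at this ⊢
    rw [this]
    exact ⟨(hcd _).1, (hcd _).2.1⟩
  · intro i hi j hj hij
    have hi := Finset.mem_range.1 (Finset.mem_coe.1 hi)
    have hj := Finset.mem_range.1 (Finset.mem_coe.1 hj)
    have h1 := hIi ⟨i, hi⟩
    have h2 := hIi ⟨j, hj⟩
    simp only at h1 h2
    simp only [Function.onFun, h1, h2]
    rw [uIoc_of_le (hcd _).2.2, uIoc_of_le (hcd _).2.2, Ioc_disjoint_Ioc]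
    have h3 : Disjoint (Ioo (c ⟨i, hi⟩) (d ⟨i, hi⟩)) (Ioo (c ⟨j, hj⟩) (d ⟨j, hj⟩)) :=
      hdisj (i := ⟨i, hi⟩) (j := ⟨j, hj⟩) (by simpa using hij)
    rwa [Ioo_disjoint_Ioo] at h3
  · simpa only [Finset.sum_range, hdI] using hlt

/-! ### ACG functions -/

namespace ACG

variable {F H : ℝ → ℝ} {a b : ℝ}

theorem of_acOn (hc : ContinuousOn F (Icc a b)) (h : ACOn F (Icc a b)) : ACG F a b :=
  ⟨hc, fun _ => Icc a b, iUnion_const _, fun _ => h⟩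

theorem mono (h : ACG F a b) {a' b' : ℝ} (ha : a ≤ a') (hb : b' ≤ b) : ACG F a' b' := by
  obtain ⟨hc, E, hE, hF⟩ := h
  refine ⟨hc.mono (Icc_subset_Icc ha hb), fun n => E n ∩ Icc a' b', ?_,
    fun n => (hF n).mono inter_subset_left⟩
  rw [← iUnion_inter, hE, inter_eq_right]
  exact Icc_subset_Icc ha hb

theorem add (hF : ACG F a b) (hH : ACG H a b) : ACG (fun x => F x + H x) a b := by
  obtain ⟨hFc, E, hE, hF⟩ := hF
  obtain ⟨hHc, E', hE', hH⟩ := hH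
  refine ⟨hFc.add hHc, fun n => E n.unpair.1 ∩ E' n.unpair.2, ?_, fun n =>
    ((hF _).mono inter_subset_left).add ((hH _).mono inter_subset_right)⟩
  refine Subset.antisymm (iUnion_subset fun n => ?_) fun x hx => ?_
  · rw [← hE]; exact inter_subset_left.trans (subset_iUnion E _)
  · obtain ⟨n, hn⟩ := mem_iUnion.1 (hE.symm ▸ hx)
    obtain ⟨m, hm⟩ := mem_iUnion.1 (hE'.symm ▸ hx)
    exact mem_iUnion.2 ⟨Nat.pair n m, by simpa using ⟨hn, hm⟩⟩

theorem neg (hF : ACG F a b) : ACG (fun x => -F x) a b := by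
  obtain ⟨hFc, E, hE, hF⟩ := hF
  exact ⟨hFc.neg, E, hE, fun n => (hF n).neg⟩

theorem volume_image_eq_zero (hF : ACG F a b) {Z : Set ℝ} (hZ : Z ⊆ Icc a b)
    (hZ0 : volume Z = 0) : volume (F '' Z) = 0 := by
  obtain ⟨-, E, hE, hF⟩ := hF
  have : F '' Z ⊆ ⋃ n, F '' (Z ∩ E n) := by
    rw [← image_iUnion, ← inter_iUnion, hE, inter_eq_left.2 hZ]
  refine measure_mono_null this (measure_iUnion_null fun n => ?_)
  exact ((hF n).mono inter_subset_right).volume_image_eq_zero (measure_mono_null inter_subset_left hZ0)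

/-- By condition (N) the exceptional set has a null image, so if `F b < F a` some level `y` strictly
between avoids it. At the last point `x` with `F x ≥ y` one has `F x = y` and `F < y` to the right,
so right slopes are negative, against the positive approximate derivative at `x`. -/
theorem le_of_ae_hasApproxDerivAt_pos (hab : a ≤ b) (hF : ACG F a b)
    (hd : ∀ᵐ x ∂volume.restrict (Icc a b), ∃ v, 0 < v ∧ HasApproxDerivAt F v x) : F a ≤ F b := by
  by_contra! hlt
  set Z : Set ℝ := {x | ¬∃ v, 0 < v ∧ HasApproxDerivAt F v x} ∩ Icc a b with hZ
  have hZ0 : volume Z = 0 := by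
    rw [ae_restrict_iff' measurableSet_Icc, ae_iff] at hd
    refine measure_mono_null (fun x hx => ?_) hd
    exact fun h => hx.1 (h hx.2)
  have hFZ := hF.volume_image_eq_zero inter_subset_right hZ0
  obtain ⟨y, hy, hyZ⟩ : ∃ y ∈ Ioo (F b) (F a), y ∉ F '' Z := by
    by_contra! hno
    have := measure_mono_null hno hFZ
    rw [Real.volume_Ioo, ENNReal.ofReal_eq_zero] at this
    linarith
  set L : Set ℝ := Icc a b ∩ F ⁻¹' Ici y with hL
  have hLc : IsClosed L := hF.1.preimage_isClosed_of_isClosed isClosed_Icc isClosed_Ici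
  have hLcomp : IsCompact L := isCompact_Icc.of_isClosed_subset hLc inter_subset_left
  have hLne : L.Nonempty := ⟨a, left_mem_Icc.2 hab, hy.2.le⟩
  have hxL := hLcomp.sSup_mem hLne
  set x := sSup L with hx
  have hright : ∀ z ∈ Ioc x b, F z < y := fun z hz => by
    by_contra! hzy
    exact hz.1.not_ge (le_csSup hLcomp.bddAbove ⟨⟨hxL.1.1.trans hz.1.le, hz.2⟩, hzy⟩)
  have hxb : x < b := lt_of_le_of_ne hxL.1.2 fun h => by
    have := hxL.2
    rw [mem_preimage, h, mem_Ici] at this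
    linarith [hy.1]
  have hFx : F x = y := by
    refine le_antisymm ?_ hxL.2
    have h1 : Tendsto F (𝓝[Ioc x b] x) (𝓝 (F x)) :=
      (hF.1 x hxL.1).mono_left (nhdsWithin_mono _ fun z hz => ⟨hxL.1.1.trans hz.1.le, hz.2⟩)
    have : (𝓝[Ioc x b] x).NeBot := by
      rw [nhdsWithin_Ioc_eq_nhdsGT hxb]; infer_instance
    exact le_of_tendsto h1 (eventually_mem_nhdsWithin.mono fun z hz => (hright z hz).le)
  have hxZ : ∃ v, 0 < v ∧ HasApproxDerivAt F v x := by
    by_contra hno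
    exact hyZ ⟨x, ⟨hno, hxL.1⟩, hFx⟩
  obtain ⟨v, hv, hvx⟩ := hxZ
  obtain ⟨l, hl, hlx, hslope⟩ := hvx.exists_tendsto_slope_right
  refine hv.not_ge (le_of_tendsto hslope (hlx ?_))
  filter_upwards [Ioc_mem_nhdsGT hxb] with z hz
  rw [slope_def_field, hFx]
  exact div_nonpos_of_nonpos_of_nonneg (by linarith [hright z hz]) (by linarith [hz.1])

theorem le_of_ae_hasApproxDerivAt_nonneg (hab : a ≤ b) (hF : ACG F a b)
    (hd : ∀ᵐ x ∂volume.restrict (Icc a b), ∃ v, 0 ≤ v ∧ HasApproxDerivAt F v x) : F a ≤ F b := by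
  have key : ∀ e : ℝ, 0 < e → F a + e * a ≤ F b + e * b := fun e he => by
    refine le_of_ae_hasApproxDerivAt_pos hab (hF.add (of_acOn (by fun_prop)
      (ACOn.const_mul_id he _))) ?_
    filter_upwards [hd] with x hx
    obtain ⟨v, hv, hvx⟩ := hx
    refine ⟨v + e, by linarith, hvx.add (HasDerivAt.hasApproxDerivAt ?_)⟩
    simpa using (hasDerivAt_id x).const_mul e
  refine le_of_forall_pos_le_add fun η hη => ?_
  -- The `+ 1` keeps the denominator positive when `a = b`.
  have h1 := key (η / (b - a + 1)) (div_pos hη (by linarith))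
  have h2 : η / (b - a + 1) * (b - a) ≤ η := by
    rw [div_mul_eq_mul_div, div_le_iff₀ (by linarith)]
    nlinarith
  linarith

theorem of_integrableOn {g : ℝ → ℝ} (hab : a ≤ b) (hg : IntegrableOn g (Icc a b)) :
    ACG (fun x => ∫ t in a..x, g t) a b ∧
      ∀ᵐ x ∂volume.restrict (Icc a b), HasApproxDerivAt (fun x => ∫ t in a..x, g t) (g x) x := by
  have hi : IntervalIntegrable g volume a b := by
    rw [intervalIntegrable_iff_integrableOn_Icc_of_le hab]; exact hg
  have hac := hi.absolutelyContinuousOnInterval_intervalIntegral left_mem_uIcc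
  refine ⟨of_acOn (by simpa [uIcc_of_le hab] using hac.continuousOn)
    (AbsolutelyContinuousOnInterval.acOn hab hac), ?_⟩
  rw [ae_restrict_iff' measurableSet_Icc]
  filter_upwards [hi.ae_hasDerivAt_integral] with x hx hxI
  rw [uIcc_of_le hab] at hx
  exact HasDerivAt.hasApproxDerivAt (hx hxI a (left_mem_Icc.2 hab))

end ACG

/-- The primitive `F` is monotone, so Lebesgue's theorem makes it differentiable almost everywhere
with integrable derivative, and this derivative is `g`. The differences of `F` and the Lebesgue
primitive, in both orders, have approximate derivative `0` almost everywhere, so the two increments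
agree. -/
theorem HasDenjoyIntegral.integrableOn_of_nonneg {g : ℝ → ℝ} {a b v : ℝ} (hab : a < b)
    (h : HasDenjoyIntegral g a b v) (hg : 0 ≤ᵐ[volume.restrict (Icc a b)] g) :
    IntegrableOn g (Icc a b) ∧ ∫ t in Icc a b, g t = v := by
  obtain ⟨F, hF, hd, rfl⟩ := h
  have hmono : MonotoneOn F (Icc a b) := fun x hx y hy hxy => by
    refine (hF.mono hx.1 hy.2).le_of_ae_hasApproxDerivAt_nonneg hxy ?_
    refine ae_mono (Measure.restrict_mono_set _ (Icc_subset_Icc hx.1 hy.2)) ?_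
    filter_upwards [hd, hg] with t h1 h2
    exact ⟨g t, h2, h1⟩
  have hderiv : g =ᵐ[volume.restrict (Icc a b)] deriv F := by
    have hdiff := hmono.ae_differentiableWithinAt measurableSet_Icc
    rw [← restrict_Ioo_eq_restrict_Icc] at hd hdiff ⊢
    filter_upwards [hd, hdiff, ae_restrict_mem measurableSet_Ioo] with t h1 h2 h3
    exact h1.eq_of_hasDerivAt (h2.differentiableAt (Icc_mem_nhds h3.1 h3.2)).hasDerivAt
  have hint : IntegrableOn g (Icc a b) := by
    have h1 := MonotoneOn.intervalIntegrable_deriv (f := F) (a := a) (b := b)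
      (by rwa [uIcc_of_le hab.le])
    rw [intervalIntegrable_iff_integrableOn_Icc_of_le hab.le] at h1
    exact h1.congr hderiv.symm
  refine ⟨hint, ?_⟩
  obtain ⟨hG, hGd⟩ := ACG.of_integrableOn hab.le hint
  have h1 := (hF.add hG.neg).le_of_ae_hasApproxDerivAt_nonneg hab.le (by
    filter_upwards [hd, hGd] with t h1 h2
    exact ⟨g t + -g t, by simp, h1.add h2.neg⟩)
  have h2 := (hG.add hF.neg).le_of_ae_hasApproxDerivAt_nonneg hab.le (by
    filter_upwards [hd, hGd] with t h1 h2
    exact ⟨g t + -g t, by simp, h2.add h1.neg⟩)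
  rw [integral_Icc_eq_integral_Ioc, ← intervalIntegral.integral_of_le hab.le]
  simp only [intervalIntegral.integral_same] at h1 h2
  linarith

/-! ### Integrals on compact intervals extending the Lebesgue integral -/

/-- The properties of a real integral `J` on compact intervals that relate scalarly `J`-integrable
multifunctions to Pettis integrable ones: linearity, invariance under modifications on null sets,
extension of the Lebesgue integral, and agreement with it on nonnegative functions. -/
structure IsLebesgueExtension (J : (ℝ → ℝ) → ℝ → ℝ → ℝ → Prop) : Prop where
  add : ∀ {g h : ℝ → ℝ} {a b v w : ℝ}, J g a b v → J h a b w → J (fun t => g t + h t) a b (v + w)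
  neg : ∀ {g : ℝ → ℝ} {a b v : ℝ}, J g a b v → J (fun t => -g t) a b (-v)
  congr_ae : ∀ {g h : ℝ → ℝ} {a b v : ℝ}, J g a b v → g =ᵐ[volume.restrict (Icc a b)] h → J h a b v
  of_integrableOn : ∀ {g : ℝ → ℝ} {a b : ℝ}, a < b → IntegrableOn g (Icc a b) →
    J g a b (∫ t in Icc a b, g t)
  integrableOn_of_nonneg : ∀ {g : ℝ → ℝ} {a b v : ℝ}, a < b → J g a b v →
    0 ≤ᵐ[volume.restrict (Icc a b)] g → IntegrableOn g (Icc a b) ∧ ∫ t in Icc a b, g t = v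

theorem isLebesgueExtension_denjoy : IsLebesgueExtension HasDenjoyIntegral where
  add := by
    rintro g h a b _ _ ⟨F, hF, hd, rfl⟩ ⟨H, hH, hd', rfl⟩
    refine ⟨_, hF.add hH, ?_, by ring⟩
    filter_upwards [hd, hd'] with t h1 h2
    exact h1.add h2
  neg := by
    rintro g a b _ ⟨F, hF, hd, rfl⟩
    refine ⟨_, hF.neg, ?_, by ring⟩
    filter_upwards [hd] with t h1
    exact h1.neg
  congr_ae := by
    rintro g h a b _ ⟨F, hF, hd, rfl⟩ hgh
    refine ⟨F, hF, ?_, rfl⟩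
    filter_upwards [hd, hgh] with t h1 h2
    rwa [← h2]
  of_integrableOn := by
    intro g a b hab hg
    obtain ⟨h1, h2⟩ := ACG.of_integrableOn hab.le hg
    refine ⟨_, h1, h2, ?_⟩
    rw [intervalIntegral.integral_same, sub_zero, integral_Icc_eq_integral_Ioc,
      ← intervalIntegral.integral_of_le hab.le]
  integrableOn_of_nonneg := fun hab h hg => h.integrableOn_of_nonneg hab hg

/-! ### The Henstock-Kurzweil integral -/

/-- The one-dimensional box `(a, b]`. -/
def segment1 (a b : ℝ) (hab : a < b) : BoxIntegral.Box (Fin 1) :=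
  ⟨fun _ => a, fun _ => b, fun _ => hab⟩

theorem coe_segment1 {a b : ℝ} (hab : a < b) :
    (segment1 a b hab : Set (Fin 1 → ℝ)) = MeasurableEquiv.funUnique (Fin 1) ℝ ⁻¹' Ioc a b := by
  ext x
  simp [segment1, BoxIntegral.Box.mem_def, Fin.forall_fin_one]

theorem mem_Icc_segment1 {a b : ℝ} (hab : a < b) {x : Fin 1 → ℝ} :
    x ∈ BoxIntegral.Box.Icc (segment1 a b hab) ↔ x 0 ∈ Icc a b := by
  simp [segment1, BoxIntegral.Box.Icc_def, Pi.le_def, Fin.forall_fin_one]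

theorem segment1_le {a b c d : ℝ} (hab : a < b) (hcd : c < d) (hca : c ≤ a) (hbd : b ≤ d) :
    segment1 a b hab ≤ segment1 c d hcd :=
  BoxIntegral.Box.le_iff_bounds.2 ⟨fun _ => hca, fun _ => hbd⟩

theorem measurePreserving_restrict_segment1 {a b : ℝ} (hab : a < b) :
    MeasurePreserving (MeasurableEquiv.funUnique (Fin 1) ℝ)
      (volume.restrict (segment1 a b hab : Set (Fin 1 → ℝ))) (volume.restrict (Ioc a b)) := by
  rw [coe_segment1]
  exact (volume_preserving_funUnique (Fin 1) ℝ).restrict_preimage measurableSet_Ioc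

/-- The vector measure of boxes with respect to which Henstock-Kurzweil sums are formed. -/
abbrev vol1 : BoxIntegral.BoxAdditiveMap (Fin 1) (ℝ →L[ℝ] ℝ) ⊤ :=
  (volume : Measure (Fin 1 → ℝ)).toBoxAdditive.toSMul

theorem vol1_segment1 {a b : ℝ} (hab : a < b) (y : ℝ) :
    vol1 (segment1 a b hab) y = y * (b - a) := by
  have := BoxIntegral.BoxAdditiveMap.volume_apply (segment1 a b hab) y
  rw [BoxIntegral.BoxAdditiveMap.volume] at this
  rw [this]
  simp [segment1, mul_comm]

theorem HasHKIntegral.congr_ae {g h : ℝ → ℝ} {a b v : ℝ} (hg : HasHKIntegral g a b v)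
    (hgh : g =ᵐ[volume.restrict (Icc a b)] h) : HasHKIntegral h a b v := by
  obtain ⟨hab, hg⟩ := hg
  refine ⟨hab, hg.congr_ae ?_ rfl⟩
  rw [← restrict_Ioc_eq_restrict_Icc] at hgh
  exact (measurePreserving_restrict_segment1 hab).quasiMeasurePreserving.ae hgh

theorem HasHKIntegral.of_integrableOn {g : ℝ → ℝ} {a b : ℝ} (hab : a < b)
    (hg : IntegrableOn g (Icc a b)) : HasHKIntegral g a b (∫ t in Icc a b, g t) := by
  refine ⟨hab, ?_⟩
  have hmp := measurePreserving_restrict_segment1 hab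
  have hemb := (MeasurableEquiv.funUnique (Fin 1) ℝ).measurableEmbedding
  have hg' : IntegrableOn g (Ioc a b) := hg.mono_set Ioc_subset_Icc_self
  have h1 : IntegrableOn (fun x : Fin 1 → ℝ => g (x 0)) (segment1 a b hab : Set (Fin 1 → ℝ)) :=
    (hmp.integrable_comp_emb hemb).2 hg'
  have h2 := h1.hasBoxIntegral BoxIntegral.IntegrationParams.Henstock rfl
  have h3 : ∫ x in (segment1 a b hab : Set (Fin 1 → ℝ)), g (x 0) = ∫ t in Icc a b, g t := by
    rw [integral_Icc_eq_integral_Ioc]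
    exact hmp.integral_comp hemb g
  rwa [h3] at h2

/-- The indefinite Henstock-Kurzweil integral. -/
def hkPrimitive (g : ℝ → ℝ) (a x : ℝ) : ℝ :=
  if hx : a < x then
    BoxIntegral.integral (segment1 a x hx) BoxIntegral.IntegrationParams.Henstock
      (fun y : Fin 1 → ℝ => g (y 0)) vol1
  else 0

/-! ### Saks-Henstock lemma and almost everywhere differentiation of the Henstock-Kurzweil primitive
-/

section Primitive

variable {g : ℝ → ℝ} {a b : ℝ} {hab : a < b}

theorem integral_segment1 (hg : BoxIntegral.Integrable (segment1 a b hab)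
      BoxIntegral.IntegrationParams.Henstock (fun y : Fin 1 → ℝ => g (y 0)) vol1)
    {l u : ℝ} (hal : a ≤ l) (hlu : l < u) (hub : u ≤ b) :
    BoxIntegral.integral (segment1 l u hlu) BoxIntegral.IntegrationParams.Henstock
      (fun y : Fin 1 → ℝ => g (y 0)) vol1 = hkPrimitive g a u - hkPrimitive g a l := by
  rcases hal.eq_or_lt with rfl | hal
  · simp [hkPrimitive, hlu]
  have hau := hal.trans hlu
  have h1 := hg.toBoxAdditive.map_split_add (I := segment1 a u hau)
    (WithTop.coe_le_coe.2 (segment1_le hau hab le_rfl hub)) 0 l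
  have hl : l ∈ Ioo ((segment1 a u hau).lower 0) ((segment1 a u hau).upper 0) := ⟨hal, hlu⟩
  have e1 : Function.update (segment1 a u hau).upper 0 l = fun _ => l := by
    ext i; rw [Subsingleton.elim i 0, Function.update_self]
  have e2 : Function.update (segment1 a u hau).lower 0 l = fun _ => l := by
    ext i; rw [Subsingleton.elim i 0, Function.update_self]
  rw [BoxIntegral.Box.splitLower_def hl (fun j => by rw [e1]; exact hal),
    BoxIntegral.Box.splitUpper_def hl (fun j => by rw [e2]; exact hlu)] at h1
  simp only [e1, e2, BoxIntegral.Integrable.toBoxAdditive_apply] at h1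
  simp only [hkPrimitive, hal, hau, dif_pos]
  exact eq_sub_of_add_eq' h1

theorem monotoneOn_hkPrimitive (hg : BoxIntegral.Integrable (segment1 a b hab)
      BoxIntegral.IntegrationParams.Henstock (fun y : Fin 1 → ℝ => g (y 0)) vol1)
    (h0 : ∀ x, 0 ≤ g x) : MonotoneOn (hkPrimitive g a) (Icc a b) := fun l hl u hu hlu => by
  rcases hlu.eq_or_lt with rfl | hlu
  · rfl
  rw [← sub_nonneg, ← integral_segment1 hg hl.1 hlu hu.2]
  exact BoxIntegral.integral_nonneg (l := BoxIntegral.IntegrationParams.Henstock)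
    (g := fun y : Fin 1 → ℝ => g (y 0)) (fun x _ => h0 _) volume

/-- The **Saks-Henstock lemma** for one-dimensional Henstock-Kurzweil integrals. -/
theorem exists_gauge (hg : BoxIntegral.Integrable (segment1 a b hab)
      BoxIntegral.IntegrationParams.Henstock (fun y : Fin 1 → ℝ => g (y 0)) vol1)
    {ε : ℝ} (hε : 0 < ε) : ∃ r : ℝ → ℝ, (∀ x, 0 < r x) ∧
      ∀ (s : Finset (ℝ × ℝ)) (t : ℝ × ℝ → ℝ),
        (∀ p ∈ s, a ≤ p.1 ∧ p.1 < p.2 ∧ p.2 ≤ b ∧ t p ∈ Icc p.1 p.2 ∧ p.2 - p.1 ≤ r (t p)) →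
        ((s : Set (ℝ × ℝ)).Pairwise fun p q => Disjoint (Ioc p.1 p.2) (Ioc q.1 q.2)) →
        |∑ p ∈ s, (g (t p) * (p.2 - p.1) - (hkPrimitive g a p.2 - hkPrimitive g a p.1))| ≤ ε := by
  refine ⟨fun x => hg.convergenceR ε 0 fun _ => x, fun x => (hg.convergenceR ε 0 fun _ => x).2,
    fun s t hs hdisj => ?_⟩
  classical
  set B : s → BoxIntegral.Box (Fin 1) := fun p => segment1 p.1.1 p.1.2 (hs p.1 p.2).2.1 with hB
  have hBinj : Function.Injective B := fun p q hpq => by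
    have h1 := congrArg (fun J : BoxIntegral.Box (Fin 1) => (J.lower 0, J.upper 0)) hpq
    exact Subtype.ext h1
  set π : BoxIntegral.TaggedPrepartition (segment1 a b hab) :=
    { boxes := s.attach.image B
      le_of_mem' := by
        intro J hJ
        obtain ⟨p, -, rfl⟩ := Finset.mem_image.1 hJ
        obtain ⟨h1, h2, h3, -⟩ := hs p.1 p.2
        exact segment1_le h2 hab h1 h3
      pairwiseDisjoint := by
        intro J hJ J' hJ' hne
        obtain ⟨p, -, rfl⟩ := Finset.mem_image.1 (Finset.mem_coe.1 hJ)
        obtain ⟨q, -, rfl⟩ := Finset.mem_image.1 (Finset.mem_coe.1 hJ')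
        have hpq : (p : ℝ × ℝ) ≠ q := fun h => hne (by rw [Subtype.ext h])
        simp only [Function.onFun, hB]
        rw [coe_segment1, coe_segment1]
        exact (hdisj p.2 q.2 hpq).preimage _
      -- A tagged prepartition assigns a tag in the large box to every box, even one outside the
      -- family; clamping to `[a, b]` ensures this and changes nothing on the boxes of `s`.
      tag := fun J _ => max a (min b (t (J.lower 0, J.upper 0)))
      tag_mem_Icc := fun J => (mem_Icc_segment1 hab).2
        ⟨le_max_left _ _, max_le hab.le (min_le_left _ _)⟩ } with hπ
  have htag : ∀ p : s, π.tag (B p) = fun _ => t p := fun p => by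
    obtain ⟨h1, h2, h3, h4, -⟩ := hs p.1 p.2
    funext i
    change max a (min b (t p)) = t p
    rw [min_eq_right (h4.2.trans h3), max_eq_right (h1.trans h4.1)]
  have hbase : BoxIntegral.IntegrationParams.Henstock.MemBaseSet (segment1 a b hab) 0
      (hg.convergenceR ε 0) π := by
    refine ⟨fun J hJ => ?_, fun _ J hJ => ?_, fun h => (Bool.false_ne_true h).elim,
      fun h => (Bool.false_ne_true h).elim⟩
    · obtain ⟨p, -, rfl⟩ := Finset.mem_image.1 hJ
      obtain ⟨h1, h2, h3, h4, h5⟩ := hs p.1 p.2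
      intro x hx
      have hx := (mem_Icc_segment1 h2).1 hx
      rw [htag, Metric.mem_closedBall, dist_pi_le_iff (hg.convergenceR ε 0 fun _ => t p).2.le]
      intro i
      rw [Subsingleton.elim i 0, Real.dist_eq]
      refine le_trans ?_ h5
      rw [abs_le]
      constructor <;> linarith [hx.1, hx.2, h4.1, h4.2]
    · obtain ⟨p, -, rfl⟩ := Finset.mem_image.1 hJ
      obtain ⟨h1, h2, h3, h4, h5⟩ := hs p.1 p.2
      rw [htag]
      exact (mem_Icc_segment1 h2).2 h4
  have h1 := hg.dist_integralSum_sum_integral_le_of_memBaseSet hε hbase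
  have h2 : BoxIntegral.integralSum (fun y : Fin 1 → ℝ => g (y 0)) vol1 π =
      ∑ p ∈ s, g (t p) * (p.2 - p.1) := by
    rw [BoxIntegral.integralSum, ← Finset.sum_attach s]
    refine (Finset.sum_image hBinj.injOn).trans (Finset.sum_congr rfl fun p _ => ?_)
    rw [htag]
    exact vol1_segment1 _ _
  have h3 : ∑ J ∈ π.boxes, BoxIntegral.integral J BoxIntegral.IntegrationParams.Henstock
      (fun y : Fin 1 → ℝ => g (y 0)) vol1 =
      ∑ p ∈ s, (hkPrimitive g a p.2 - hkPrimitive g a p.1) := by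
    rw [← Finset.sum_attach s]
    refine (Finset.sum_image hBinj.injOn).trans (Finset.sum_congr rfl fun p _ => ?_)
    obtain ⟨h1, h2, h3, -⟩ := hs p.1 p.2
    exact integral_segment1 hg h1 h2 h3
  rw [h2, h3, Real.dist_eq, ← Finset.sum_sub_distrib] at h1
  exact h1

/-- The set of points at which the difference quotients of the primitive stay on one side of the
integrand, at a positive distance, is null. -/
theorem volume_eq_zero_of_gap (hg : BoxIntegral.Integrable (segment1 a b hab)
      BoxIntegral.IntegrationParams.Henstock (fun y : Fin 1 → ℝ => g (y 0)) vol1)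
    {E : Set ℝ} (hE : E ⊆ Ioo a b) {σ η : ℝ} (hσ : |σ| ≤ 1) (hη : 0 < η)
    (h : ∀ x ∈ E, ∃ ρ > 0, ∀ l u, a ≤ l → l ≤ x → x ≤ u → u ≤ b → u - l < ρ →
      η * (u - l) ≤ σ * (g x * (u - l) - (hkPrimitive g a u - hkPrimitive g a l))) :
    volume E = 0 := by
  choose! ρ hρ h using h
  have key : ∀ ε : ℝ, 0 < ε → volume E ≤ ENNReal.ofReal (ε / η) := fun ε hε => by
    obtain ⟨r, hr, hsum⟩ := exists_gauge hg hε
    -- On `D k` the local scale `ρ` and the gauge `r` both exceed `1 / (k + 1)`. A uniform grid of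
    -- smaller mesh, with the cells meeting `D k` tagged by points of `D k`, is then admissible for
    -- Saks-Henstock, and no Vitali covering is needed. Each such cell contributes at least `η * w`
    -- with the same sign, so their total length is at most `ε / η`.
    set D : ℕ → Set ℝ := fun k => {x ∈ E | 1 / ((k : ℝ) + 1) < min (ρ x) (r x)} with hD
    have hDmono : Monotone D := fun k m hkm x hx => by
      refine ⟨hx.1, lt_of_le_of_lt ?_ hx.2⟩
      have : (k : ℝ) ≤ m := by exact_mod_cast hkm
      gcongr
    have hDE : E = ⋃ k, D k := by
      refine Subset.antisymm (fun x hx => ?_) (iUnion_subset fun k x hx => hx.1)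
      obtain ⟨k, hk⟩ := exists_nat_one_div_lt (lt_min (hρ x hx) (hr x))
      exact mem_iUnion.2 ⟨k, hx, hk⟩
    rw [hDE, hDmono.measure_iUnion]
    refine iSup_le fun k => ?_
    obtain ⟨N, hN⟩ := exists_nat_gt ((b - a) * ((k : ℝ) + 1))
    have hk : (0 : ℝ) < (k : ℝ) + 1 := by positivity
    have hba : 0 < b - a := sub_pos.2 hab
    have hN0 : (0 : ℝ) < N := lt_of_le_of_lt (by positivity) hN
    set w : ℝ := (b - a) / N with hw
    have hw0 : 0 < w := by positivity
    have hwk : w < 1 / ((k : ℝ) + 1) := by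
      rw [hw, div_lt_div_iff₀ hN0 hk]; linarith
    have hNw : N * w = b - a := mul_div_cancel₀ _ hN0.ne'
    set c : ℕ → ℝ := fun j => a + j * w with hc
    have hcmono : StrictMono c := strictMono_nat_of_lt_succ fun j => by
      simp only [hc]; push_cast; linarith
    have hcs : ∀ j, c (j + 1) - c j = w := fun j => by simp only [hc]; push_cast; ring
    classical
    set J : Finset ℕ := (Finset.range N).filter fun j => (Ioc (c j) (c (j + 1)) ∩ D k).Nonempty with hJ
    have htag : ∀ j ∈ J, ∃ x, x ∈ Ioc (c j) (c (j + 1)) ∩ D k := fun j hj =>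
      (Finset.mem_filter.1 hj).2
    choose! τ hτ using htag
    set P : ℕ → ℝ × ℝ := fun j => (c j, c (j + 1)) with hP
    have hPinj : Function.Injective P := fun i j hij => hcmono.injective (congrArg Prod.fst hij)
    -- Saks-Henstock takes tags as a function of the interval; `Function.invFun P` recovers the cell
    -- index from it.
    have hinv : ∀ j, Function.invFun P (P j) = j := Function.leftInverse_invFun hPinj
    have hcb : ∀ j ∈ J, c (j + 1) ≤ b := fun j hj => by
      have h1 : j + 1 ≤ N := Finset.mem_range.1 (Finset.mem_filter.1 hj).1
      have h2 := hcmono.monotone h1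
      have h3 : c N = b := by simp only [hc]; rw [hNw]; ring
      linarith
    have hca : ∀ j, a ≤ c j := fun j => by simp only [hc]; nlinarith [(Nat.cast_nonneg j : (0 : ℝ) ≤ j)]
    have h1 := hsum (J.image P) (fun p => τ (Function.invFun P p)) (by
        intro p hp
        obtain ⟨j, hj, rfl⟩ := Finset.mem_image.1 hp
        rw [hinv]
        obtain ⟨h1, h2⟩ := hτ j hj
        refine ⟨hca j, hcmono j.lt_succ_self, hcb j hj, Ioc_subset_Icc_self h1, ?_⟩
        simp only [hP]
        rw [hcs]
        exact (hwk.trans (h2.2.trans_le (min_le_right _ _))).le) (by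
        intro p hp q hq hpq
        obtain ⟨i, hi, rfl⟩ := Finset.mem_image.1 (Finset.mem_coe.1 hp)
        obtain ⟨j, hj, rfl⟩ := Finset.mem_image.1 (Finset.mem_coe.1 hq)
        exact hcmono.monotone.pairwise_disjoint_on_Ioc_succ fun h => hpq (by rw [h]))
    rw [Finset.sum_image hPinj.injOn] at h1
    simp only [hinv] at h1
    have h2 : ∑ j ∈ J, η * w ≤ σ * ∑ j ∈ J, (g (τ j) * ((P j).2 - (P j).1) -
        (hkPrimitive g a (P j).2 - hkPrimitive g a (P j).1)) := by
      rw [Finset.mul_sum]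
      refine Finset.sum_le_sum fun j hj => ?_
      obtain ⟨h1, h2⟩ := hτ j hj
      have := h (τ j) h2.1 (c j) (c (j + 1)) (hca j) h1.1.le h1.2 (hcb j hj)
        (by rw [hcs]; exact hwk.trans (h2.2.trans_le (min_le_left _ _)))
      rw [hcs] at this
      simp only [hP]
      rw [hcs]
      exact this
    have h3 : ∑ j ∈ J, η * w ≤ ε := by
      refine h2.trans ((le_abs_self _).trans ?_)
      rw [abs_mul]
      calc _ ≤ 1 * ε := mul_le_mul hσ h1 (abs_nonneg _) zero_le_one
        _ = ε := one_mul ε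
    have hcover : D k ⊆ ⋃ j ∈ J, Ioc (c j) (c (j + 1)) := fun x hx => by
      have hxab := hE hx.1
      have hxN : x ∈ ⋃ j ∈ Finset.range N, Ioc (c j) (c (j + 1)) := by
        have h4 : (0 : ℝ) < (x - a) / w := div_pos (by linarith [hxab.1]) hw0
        have h5 : 0 < ⌈(x - a) / w⌉₊ := Nat.ceil_pos.2 h4
        obtain ⟨j, hj⟩ := Nat.exists_eq_succ_of_ne_zero h5.ne'
        have h6 := Nat.le_ceil ((x - a) / w)
        have h7 := Nat.ceil_lt_add_one h4.le
        rw [hj] at h6 h7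
        push_cast at h6 h7
        have h8 : (j : ℝ) < (x - a) / w := by linarith
        rw [lt_div_iff₀ hw0] at h8
        rw [div_le_iff₀ hw0] at h6
        refine mem_biUnion (x := j) (Finset.mem_coe.2 (Finset.mem_range.2 ?_)) ⟨?_, ?_⟩
        · have h9 : (j : ℝ) * w < N * w := by rw [hNw]; linarith [hxab.2]
          exact_mod_cast lt_of_mul_lt_mul_right h9 hw0.le
        · simp only [hc]; linarith
        · simp only [hc]; push_cast; linarith
      simp only [mem_iUnion, exists_prop] at hxN ⊢
      obtain ⟨j, hj, hxj⟩ := hxN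
      exact ⟨j, Finset.mem_filter.2 ⟨hj, x, hxj, hx⟩, hxj⟩
    calc volume (D k) ≤ volume (⋃ j ∈ J, Ioc (c j) (c (j + 1))) := measure_mono hcover
      _ ≤ ∑ j ∈ J, volume (Ioc (c j) (c (j + 1))) := measure_biUnion_finset_le _ _
      _ = ENNReal.ofReal (∑ j ∈ J, w) := by
          rw [ENNReal.ofReal_sum_of_nonneg fun _ _ => hw0.le]
          exact Finset.sum_congr rfl fun j _ => by rw [Real.volume_Ioc, hcs]
      _ ≤ ENNReal.ofReal (ε / η) := by
          refine ENNReal.ofReal_le_ofReal ?_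
          rw [le_div_iff₀ hη, Finset.sum_mul]
          simpa only [mul_comm] using h3
  refine le_antisymm (ENNReal.le_of_forall_pos_le_add fun ε hε _ => ?_) zero_le
  have := key (ε * η) (by positivity)
  rw [mul_div_cancel_right₀ _ hη.ne'] at this
  simpa using this

/-- Because `l ≤ x ≤ u`, the errors of the linear approximation at `l` and at `u` add up to at most
`η * ((x - l) + (u - x))`. -/
theorem HasDerivAt.exists_abs_straddle_le {F : ℝ → ℝ} {x v : ℝ} (h : HasDerivAt F v x) {η : ℝ}
    (hη : 0 < η) : ∃ ρ > 0, ∀ l u, l ≤ x → x ≤ u → u - l < ρ →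
      |F u - F l - v * (u - l)| ≤ η * (u - l) := by
  have h1 := (hasDerivAt_iff_isLittleO.1 h).def hη
  obtain ⟨ρ, hρ, h1⟩ := Metric.eventually_nhds_iff.1 h1
  refine ⟨ρ, hρ, fun l u hl hu hlu => ?_⟩
  have h2 := h1 (y := l) (by rw [Real.dist_eq, abs_sub_comm, abs_of_nonneg] <;> linarith)
  have h3 := h1 (y := u) (by rw [Real.dist_eq, abs_of_nonneg] <;> linarith)
  rw [Real.norm_eq_abs, Real.norm_eq_abs, smul_eq_mul] at h2 h3
  rw [abs_sub_comm l x, abs_of_nonneg (sub_nonneg.2 hl)] at h2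
  rw [abs_of_nonneg (sub_nonneg.2 hu)] at h3
  rw [abs_le] at h2 h3 ⊢
  constructor <;> linarith

/-- Where the monotone primitive is differentiable and `g` differs from its derivative by at least
`2 * η` on one side, the straddle estimate costs one `η` and leaves the gap required by
`volume_eq_zero_of_gap`. The sign `σ = ±1` selects the side, and `η` runs through `1 / (n + 1)`.
Measurability of `g` is not presupposed; it follows from that of the derivative. -/
theorem ae_eq_deriv_hkPrimitive (hg : BoxIntegral.Integrable (segment1 a b hab)
      BoxIntegral.IntegrationParams.Henstock (fun y : Fin 1 → ℝ => g (y 0)) vol1)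
    (h0 : ∀ x, 0 ≤ g x) : g =ᵐ[volume.restrict (Icc a b)] deriv (hkPrimitive g a) := by
  have hdiff := (monotoneOn_hkPrimitive hg h0).ae_differentiableWithinAt measurableSet_Icc
  rw [← restrict_Ioo_eq_restrict_Icc] at hdiff ⊢
  set F := hkPrimitive g a with hF
  have hgap : ∀ σ : ℝ, |σ| = 1 → ∀ n : ℕ, volume {x | x ∈ Ioo a b ∧ DifferentiableAt ℝ F x ∧
      2 * (1 / ((n : ℝ) + 1)) ≤ σ * (g x - deriv F x)} = 0 := fun σ hσ n => by
    have hη : (0 : ℝ) < 1 / ((n : ℝ) + 1) := by positivity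
    refine volume_eq_zero_of_gap hg (fun x hx => hx.1) hσ.le hη fun x hx => ?_
    obtain ⟨ρ, hρ, h⟩ := HasDerivAt.exists_abs_straddle_le hx.2.1.hasDerivAt hη
    refine ⟨ρ, hρ, fun l u _ hl hu _ hlu => ?_⟩
    have h1 := h l u hl hu hlu
    have h2 : |σ * (F u - F l - deriv F x * (u - l))| ≤ 1 / ((n : ℝ) + 1) * (u - l) := by
      rw [abs_mul, hσ, one_mul]; exact h1
    have h3 := (abs_le.1 h2).2
    have h4 := mul_le_mul_of_nonneg_right hx.2.2 (show 0 ≤ u - l by linarith)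
    have h5 : σ * (g x * (u - l) - (F u - F l)) =
      σ * (g x - deriv F x) * (u - l) - σ * (F u - F l - deriv F x * (u - l)) := by ring
    rw [h5]
    linarith
  have hall : ∀ σ : ℝ, |σ| = 1 → ∀ᵐ x ∂volume.restrict (Ioo a b), ∀ n : ℕ,
      ¬(x ∈ Ioo a b ∧ DifferentiableAt ℝ F x ∧ 2 * (1 / ((n : ℝ) + 1)) ≤ σ * (g x - deriv F x)) :=
    fun σ hσ => ae_restrict_of_ae (ae_all_iff.2 fun n => by
      rw [ae_iff]; simpa only [not_not] using hgap σ hσ n)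
  filter_upwards [hdiff, hall 1 (by simp), hall (-1) (by simp), ae_restrict_mem measurableSet_Ioo]
    with x h1 h2 h3 hx
  have hd := h1.differentiableAt (Icc_mem_nhds hx.1 hx.2)
  have hle : ∀ σ : ℝ, (∀ n : ℕ, ¬(x ∈ Ioo a b ∧ DifferentiableAt ℝ F x ∧
      2 * (1 / ((n : ℝ) + 1)) ≤ σ * (g x - deriv F x))) → σ * (g x - deriv F x) ≤ 0 := fun σ h => by
    have hlim : Tendsto (fun n : ℕ => 2 * (1 / ((n : ℝ) + 1))) atTop (𝓝 (2 * 0)) :=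
      tendsto_one_div_add_atTop_nhds_zero_nat.const_mul 2
    rw [mul_zero] at hlim
    refine ge_of_tendsto' hlim fun n => ?_
    by_contra! hlt
    exact h n ⟨hx, hd, hlt.le⟩
  have h4 := hle 1 h2
  have h5 := hle (-1) h3
  linarith

end Primitive

theorem HasHKIntegral.unique {g : ℝ → ℝ} {a b v w : ℝ} (hv : HasHKIntegral g a b v)
    (hw : HasHKIntegral g a b w) : v = w := by
  obtain ⟨hab, hv⟩ := hv
  obtain ⟨_, hw⟩ := hw
  exact BoxIntegral.HasIntegral.unique hv hw

theorem HasHKIntegral.integrableOn_of_forall_nonneg {g : ℝ → ℝ} {a b v : ℝ}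
    (hg : HasHKIntegral g a b v) (h0 : ∀ x, 0 ≤ g x) : IntegrableOn g (Icc a b) := by
  obtain ⟨hab, hg⟩ := hg
  have hint : BoxIntegral.Integrable (segment1 a b hab) BoxIntegral.IntegrationParams.Henstock
      (fun y : Fin 1 → ℝ => g (y 0)) vol1 := ⟨v, hg⟩
  have h1 := MonotoneOn.intervalIntegrable_deriv (f := hkPrimitive g a) (a := a) (b := b)
    (by rw [uIcc_of_le hab.le]; exact monotoneOn_hkPrimitive hint h0)
  rw [intervalIntegrable_iff_integrableOn_Icc_of_le hab.le] at h1
  exact h1.congr (ae_eq_deriv_hkPrimitive hint h0).symm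

theorem HasHKIntegral.integrableOn_of_nonneg {g : ℝ → ℝ} {a b v : ℝ} (hg : HasHKIntegral g a b v)
    (h0 : 0 ≤ᵐ[volume.restrict (Icc a b)] g) :
    IntegrableOn g (Icc a b) ∧ ∫ t in Icc a b, g t = v := by
  -- The preceding lemma needs nonnegativity everywhere; passing to `|g|` changes `g` only on a null
  -- set.
  have habs : g =ᵐ[volume.restrict (Icc a b)] fun t => |g t| := by
    filter_upwards [h0] with t ht
    exact (abs_of_nonneg ht).symm
  have hi : IntegrableOn g (Icc a b) :=
    ((hg.congr_ae habs).integrableOn_of_forall_nonneg fun x => abs_nonneg _).congr habs.symm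
  obtain ⟨hab, -⟩ := id hg
  exact ⟨hi, (HasHKIntegral.of_integrableOn hab hi).unique hg⟩

theorem isLebesgueExtension_hk : IsLebesgueExtension HasHKIntegral where
  add := by
    rintro g h a b v w ⟨hab, hg⟩ ⟨_, hh⟩
    exact ⟨hab, hg.add hh⟩
  neg := by
    rintro g a b v ⟨hab, hg⟩
    exact ⟨hab, hg.neg⟩
  congr_ae := fun hg hgh => hg.congr_ae hgh
  of_integrableOn := fun hab hg => HasHKIntegral.of_integrableOn hab hg
  integrableOn_of_nonneg := fun _ hg h0 => hg.integrableOn_of_nonneg h0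

section Decomposition

variable {X : Type*} [NormedAddCommGroup X] [NormedSpace ℝ X]

/-! ### Translations -/

theorem image_add_image_neg {Y : Type*} [AddGroup Y] (C : Set Y) (w : Y) :
    (fun x => x + -w) '' ((fun x => x + w) '' C) = C := by
  rw [image_image]; simp

theorem supp_image_add (φ : StrongDual ℝ X) (C : Set X) (w : X) :
    supp φ ((fun x => x + w) '' C) = supp φ C + ((φ w : ℝ) : EReal) := by
  have key : ∀ (C : Set X) (w : X),
      supp φ ((fun x => x + w) '' C) ≤ supp φ C + ((φ w : ℝ) : EReal) := fun C w => by
    refine supp_le ?_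
    rintro _ ⟨x, hx, rfl⟩
    rw [map_add, EReal.coe_add]
    exact add_le_add_left (le_supp hx φ) _
  refine le_antisymm (key C w) ?_
  -- The reverse inequality is the same one for the translate and `-w`.
  have h := key ((fun x => x + w) '' C) (-w)
  rw [image_add_image_neg] at h
  refine (add_le_add_left h _).trans (le_of_eq ?_)
  rw [add_assoc, ← EReal.coe_add, map_neg, neg_add_cancel, EReal.coe_zero, add_zero]

theorem supp_image_add_finite {φ : StrongDual ℝ X} {C : Set X} (w : X)
    (h : supp φ C ≠ ⊤ ∧ supp φ C ≠ ⊥) :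
    (supp φ ((fun x => x + w) '' C) ≠ ⊤ ∧ supp φ ((fun x => x + w) '' C) ≠ ⊥) ∧
      (supp φ ((fun x => x + w) '' C)).toReal = (supp φ C).toReal + φ w := by
  rw [supp_image_add, ← EReal.coe_toReal h.1 h.2, ← EReal.coe_add, EReal.toReal_coe,
    EReal.toReal_coe]
  exact ⟨⟨EReal.coe_ne_top _, EReal.coe_ne_bot _⟩, rfl⟩

theorem image_add_mem_closedConvexBounded {C : Set X} (hC : C ∈ closedConvexBounded X) (w : X) :
    (fun x => x + w) '' C ∈ closedConvexBounded X := by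
  obtain ⟨⟨hne, hcl, hconv⟩, hb⟩ := hC
  refine ⟨⟨hne.image _, (Homeomorph.addRight w).isClosedMap _ hcl, ?_⟩, ?_⟩
  · simpa only [add_comm] using hconv.translate w
  · obtain ⟨B, hB⟩ := isBounded_iff_forall_norm_le.1 hb
    refine isBounded_iff_forall_norm_le.2 ⟨B + ‖w‖, ?_⟩
    rintro _ ⟨x, hx, rfl⟩
    exact (norm_add_le _ _).trans (add_le_add_left (hB x hx) _)

variable {Γ : ℝ → Set X} {f : ℝ → X}

theorem subFun_eq {Y : Type*} [NormedAddCommGroup Y] (Γ : ℝ → Set Y) (f : ℝ → Y) (t : ℝ) :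
    subFun Γ f t = (fun x => x + -f t) '' Γ t := by
  simp only [subFun, sub_eq_add_neg]

theorem SuppFinite.subFun {φ : StrongDual ℝ X} (h : SuppFinite Γ φ) (f : ℝ → X) :
    SuppFinite (subFun Γ f) φ ∧ suppFun (subFun Γ f) φ
      =ᵐ[volume.restrict (Icc (0 : ℝ) 1)] fun t => suppFun Γ φ t + -φ (f t) := by
  have key : ∀ᵐ t ∂volume.restrict (Icc (0 : ℝ) 1),
      (supp φ (Multifun.subFun Γ f t) ≠ ⊤ ∧ supp φ (Multifun.subFun Γ f t) ≠ ⊥) ∧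
        suppFun (Multifun.subFun Γ f) φ t = suppFun Γ φ t + -φ (f t) := by
    filter_upwards [h] with t ht
    rw [suppFun, suppFun, subFun_eq]
    simpa only [map_neg] using supp_image_add_finite (-f t) ht
  exact ⟨key.mono fun t ht => ht.1, key.mono fun t ht => ht.2⟩

theorem SuppFinite.of_subFun {φ : StrongDual ℝ X} (h : SuppFinite (Multifun.subFun Γ f) φ) :
    SuppFinite Γ φ ∧ suppFun Γ φ
      =ᵐ[volume.restrict (Icc (0 : ℝ) 1)] fun t => suppFun (Multifun.subFun Γ f) φ t + φ (f t) := by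
  have e : ∀ t, (fun x => x + f t) '' Multifun.subFun Γ f t = Γ t := fun t => by
    rw [subFun_eq, image_image]; simp
  have key : ∀ᵐ t ∂volume.restrict (Icc (0 : ℝ) 1), (supp φ (Γ t) ≠ ⊤ ∧ supp φ (Γ t) ≠ ⊥) ∧
      suppFun Γ φ t = suppFun (Multifun.subFun Γ f) φ t + φ (f t) := by
    filter_upwards [h] with t ht
    have := supp_image_add_finite (f t) ht
    rwa [e] at this
  exact ⟨key.mono fun t ht => ht.1, key.mono fun t ht => ht.2⟩

theorem zero_mem_subFun {Y : Type*} [NormedAddCommGroup Y] {Γ : ℝ → Set Y} {f : ℝ → Y} {t : ℝ}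
    (h : f t ∈ Γ t) : 0 ∈ subFun Γ f t :=
  ⟨f t, h, sub_self _⟩

/-! ### Decomposition of multifunctions -/

variable {J : (ℝ → ℝ) → ℝ → ℝ → ℝ → Prop}

/-- The difference `s(φ, Γ) - φ f` is `J`-integrable and nonnegative, hence Lebesgue integrable with
the same integral. So the interval integrals of `Γ - f` are represented by `N - w`, and the
extension theorem does the rest. -/
theorem IntervalIntegrableIn.pettisIntegrableIn_subFun [CompleteSpace X]
    (hJ : IsLebesgueExtension J) (hΓ : IntervalIntegrableIn J (closedConvexBounded X) Γ)
    (hf : ∀ t ∈ Icc (0 : ℝ) 1, f t ∈ Γ t) (hfJ : IntervalIntegrableFun J f) :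
    PettisIntegrableIn (closedConvexBounded X) (subFun Γ f) := by
  have h0 : ∀ t ∈ Icc (0 : ℝ) 1, 0 ∈ subFun Γ f t := fun t ht => zero_mem_subFun (hf t ht)
  have hint : ∀ a b : ℝ, 0 ≤ a → a < b → b ≤ 1 → ∃ N : Set X, Bornology.IsBounded N ∧
      ∀ φ : StrongDual ℝ X, IntegrableOn (suppFun (subFun Γ f) φ) (Icc a b) ∧
        supp φ N = (suppIntegral (subFun Γ f) (Icc a b) φ : EReal) := fun a b ha hab hb => by
    obtain ⟨N, hN, hNφ⟩ := hΓ.2 a b ha hab hb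
    obtain ⟨w, hw⟩ := hfJ.2 a b ha hab hb
    have hsub : Icc a b ⊆ Icc 0 1 := Icc_subset_Icc ha hb
    refine ⟨_, (image_add_mem_closedConvexBounded hN (-w)).2, fun φ => ?_⟩
    obtain ⟨v, hv, hvN⟩ := hNφ φ
    have h1 := hJ.congr_ae (hJ.add hv (hJ.neg (hw φ)))
      (ae_restrict_of_subset hsub ((hΓ.1 φ).1.subFun f).2.symm)
    obtain ⟨h2, h3⟩ := hJ.integrableOn_of_nonneg hab h1
      (ae_restrict_of_subset hsub (ae_suppFun_nonneg h0 φ))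
    refine ⟨h2, ?_⟩
    rw [supp_image_add, hvN, map_neg, ← EReal.coe_add, suppIntegral, h3]
  have hS : ScalarlyIntegrable (subFun Γ f) := fun φ => by
    obtain ⟨N, -, hN⟩ := hint 0 1 le_rfl one_pos le_rfl
    exact ⟨((hΓ.1 φ).1.subFun f).1, (hN φ).1⟩
  refine pettisIntegrableIn_of_intervals h0 hS fun a b ha hab hb => ?_
  obtain ⟨N, hNb, hN⟩ := hint a b ha hab hb
  exact ⟨N, hNb, fun φ => (hN φ).2⟩

theorem PettisIntegrableIn.intervalIntegrableIn_of_subFun (hJ : IsLebesgueExtension J)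
    (hP : PettisIntegrableIn (closedConvexBounded X) (subFun Γ f))
    (hfJ : IntervalIntegrableFun J f) :
    IntervalIntegrableIn J (closedConvexBounded X) Γ := by
  have hJφ : ∀ a b : ℝ, 0 ≤ a → a < b → b ≤ 1 → ∀ (φ : StrongDual ℝ X) (v : ℝ),
      J (fun t => φ (f t)) a b v →
      J (suppFun Γ φ) a b ((∫ t in Icc a b, suppFun (subFun Γ f) φ t) + v) :=
    fun a b ha hab hb φ v hv => by
      have hsub : Icc a b ⊆ Icc 0 1 := Icc_subset_Icc ha hb
      exact hJ.congr_ae (hJ.add (hJ.of_integrableOn hab ((hP.1 φ).2.mono_set hsub)) hv)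
        (ae_restrict_of_subset hsub (SuppFinite.of_subFun (hP.1 φ).1).2.symm)
  refine ⟨fun φ => ⟨(SuppFinite.of_subFun (hP.1 φ).1).1, ?_⟩, fun a b ha hab hb => ?_⟩
  · obtain ⟨v, hv⟩ := hfJ.1 φ
    exact ⟨_, hJφ 0 1 le_rfl one_pos le_rfl φ v hv⟩
  · obtain ⟨M, hM, hMφ⟩ := hP.2 (Icc a b) (Icc_subset_Icc ha hb)
      measurableSet_Icc.nullMeasurableSet
    obtain ⟨w, hw⟩ := hfJ.2 a b ha hab hb
    refine ⟨_, image_add_mem_closedConvexBounded hM w, fun φ =>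
      ⟨_, hJφ a b ha hab hb φ _ (hw φ), ?_⟩⟩
    rw [supp_image_add, hMφ φ, ← EReal.coe_add]

theorem intervalIntegrableIn_iff_pettisIntegrableIn_subFun [CompleteSpace X]
    (hJ : IsLebesgueExtension J) (hf : ∀ t ∈ Icc (0 : ℝ) 1, f t ∈ Γ t)
    (hfJ : IntervalIntegrableFun J f) :
    IntervalIntegrableIn J (closedConvexBounded X) Γ ↔
      PettisIntegrableIn (closedConvexBounded X) (subFun Γ f) :=
  ⟨fun h => h.pettisIntegrableIn_subFun hJ hf hfJ, fun h => h.intervalIntegrableIn_of_subFun hJ hfJ⟩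

theorem ScalarlyIntegrable.of_subFun (h : ScalarlyIntegrable (subFun Γ f))
    (hf : ∀ φ : StrongDual ℝ X, IntegrableOn (fun t => φ (f t)) (Icc 0 1) volume) :
    ScalarlyIntegrable Γ := fun φ => by
  obtain ⟨h1, h2⟩ := SuppFinite.of_subFun (h φ).1
  exact ⟨h1, ((h φ).2.add (hf φ)).congr h2.symm⟩

theorem tfae_of_forall_mem_iff {α : Type*} {S : Set α} {P : α → Prop} {p : Prop}
    (h : ∀ f ∈ S, (p ↔ P f)) :
    List.TFAE [p ∧ S.Nonempty, S.Nonempty ∧ ∀ f ∈ S, P f, ∃ f ∈ S, P f] := by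
  tfae_have 1 → 2 := fun ⟨hp, hS⟩ => ⟨hS, fun f hf => (h f hf).1 hp⟩
  tfae_have 2 → 3 := fun ⟨⟨f, hf⟩, hP⟩ => ⟨f, hf, hP f hf⟩
  tfae_have 3 → 1 := fun ⟨f, hf, hP⟩ => ⟨(h f hf).2 hP, f, hf⟩
  tfae_finish

end Decomposition

end Multifun
end

/-! ### The three equivalences -/

theorem theorem3p5 {X : Type*} [NormedAddCommGroup X] [NormedSpace ℝ X] [CompleteSpace X]
    (Γ : ℝ → Set X) (hΓ : ∀ t ∈ Set.Icc (0 : ℝ) 1, Γ t ∈ Multifun.closedConvex X) :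
    -- Denjoy-Pettis integrability
    List.TFAE
      [Multifun.DPIntegrableIn (Multifun.closedConvexBounded X) Γ ∧ (Multifun.selDP Γ).Nonempty,
        (Multifun.selDP Γ).Nonempty ∧ ∀ f ∈ Multifun.selDP Γ,
          Multifun.PettisIntegrableIn (Multifun.closedConvexBounded X) (Multifun.subFun Γ f),
        ∃ f ∈ Multifun.selDP Γ,
          Multifun.PettisIntegrableIn (Multifun.closedConvexBounded X) (Multifun.subFun Γ f)] ∧
    -- Henstock-Kurzweil-Pettis integrability
    List.TFAE
      [Multifun.HKPIntegrableIn (Multifun.closedConvexBounded X) Γ ∧ (Multifun.selHKP Γ).Nonempty,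
        (Multifun.selHKP Γ).Nonempty ∧ ∀ f ∈ Multifun.selHKP Γ,
          Multifun.PettisIntegrableIn (Multifun.closedConvexBounded X) (Multifun.subFun Γ f),
        ∃ f ∈ Multifun.selHKP Γ,
          Multifun.PettisIntegrableIn (Multifun.closedConvexBounded X) (Multifun.subFun Γ f)] ∧
    -- weak McShane integrability
    List.TFAE
      [Multifun.WMSIntegrableIn (Multifun.closedConvexBounded X) Γ ∧ (Multifun.selWMS Γ).Nonempty,
        (Multifun.selWMS Γ).Nonempty ∧ ∀ f ∈ Multifun.selWMS Γ,
          Multifun.PettisIntegrableIn (Multifun.closedConvexBounded X) (Multifun.subFun Γ f),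
        ∃ f ∈ Multifun.selWMS Γ,
          Multifun.PettisIntegrableIn (Multifun.closedConvexBounded X) (Multifun.subFun Γ f)] := by
  refine ⟨Multifun.tfae_of_forall_mem_iff fun f hf => ?_,
    Multifun.tfae_of_forall_mem_iff fun f hf => ?_, Multifun.tfae_of_forall_mem_iff fun f hf => ?_⟩
  · exact Multifun.intervalIntegrableIn_iff_pettisIntegrableIn_subFun
      Multifun.isLebesgueExtension_denjoy hf.1.1 hf.2
  · exact Multifun.intervalIntegrableIn_iff_pettisIntegrableIn_subFun
      Multifun.isLebesgueExtension_hk hf.1.1 hf.2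
  -- Beyond the Henstock-Kurzweil case only scalar integrability of `Γ` is left; it follows from
  -- `s(φ, Γ) = s(φ, Γ - f) + φ f` almost everywhere, a sum of Lebesgue integrable functions.
  · have h := Multifun.intervalIntegrableIn_iff_pettisIntegrableIn_subFun
      Multifun.isLebesgueExtension_hk hf.1.1 hf.2.1
    exact ⟨fun hp => h.1 hp.1, fun hP => ⟨h.2 hP, hP.1.of_subFun hf.2.2⟩⟩
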